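/- Let $n\ge 5$. A real symmetric $n\times n$ matrix $A$ is \emph{copositive} if $x^TAx\ge 0$ for all $x\in\mathbb R^n_+$, and \emph{exceptional} if it is copositive but is not the sum of a positive semi-definite matrix and a symmetric element-wise nonnegative matrix. A copositive $A\neq 0$ is \emph{extremal} if $A=B+C$ with $B,C$ copositive implies that $B$ and $C$ are nonnegative multiples of $A$. A \emph{zero} of a copositive $A$ is a non-zero $v\in\mathbb R_+^n$ with $v^TAv=0$; its support is the set of indices of its positive entries; it is \emph{minimal} if no zero of $A$ has strictly smaller support. Reading indices modulo $n$, let $I_j=(j,j+1,\dots,j+n-3)$ for $j=1,\dots,n$, and let $A_{I_j}$ denote the corresponding principal submatrix. An exceptional $A$ that has zeros $v^1,\dots,v^n$ with $\operatorname{supp}v^j=I_j$ has \emph{minimal circulant zero support set} if every zero of $A$ is proportional to one of the $v^j$, and \emph{non-minimal circulant zero support set} otherwise. Fix ${\bf u}=\{u^1,\dots,u^n\}\subset\mathbb R^n_+$ with $\operatorname{supp}u^j=I_j$ for all $j$, and let $F_{\bf u}$ be the set of copositive $A$ with $(u^j)^TAu^j=0$ for all $j$. Put $d=n-3$, and let $\mathcal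 L_{\bf u}$ be the $d$-dimensional space of real sequences $(x_t)_{t\ge1}$ satisfying $\sum_{i=0}^{d}u^t_{t+i}\,x_{t+i}=0$ for all $t\ge 1$ (upper and lower indices of $u$ modulo $n$). Let $\mathfrak M:\mathcal L_{\bf u}\to\mathcal L_{\bf u}$, $(x_t)_t\mapsto(x_{t+n})_t$, be the monodromy operator, and let ${\bf e}_t\in\mathcal L_{\bf u}^*$ be the evaluation $x\mapsto x_t$; then ${\bf e}_1,\dots,{\bf e}_d$ is a basis of $\mathcal L_{\bf u}^*$. Let $\mathcal A_{\bf u}$ be the space of real symmetric matrices $A$ with $A_{I_j}u^j_{I_j}=0$ for all $j$, and for $A\in\mathcal A_{\bf u}$ let $\Lambda(A)$ be the symmetric bilinear form $B$ on $\mathcal L_{\bf u}^*$ with $B({\bf e}_t,{\bf e}_s)=A_{ts}$ for $t,s=1,\dots,d$. Let $A\in F_{\bf u}$ be exceptional. Then $A\in\mathcal A_{\bf u}$ and, with $B=\Lambda(A)$, exactly one of the following two cases (i), (ii) holds, each with all of its assertions. (i) (a) $A$ has minimal circulant zero support set; (b) $B$ is positive definite; (c) $A_{I_j}$ has corank $1$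 for every $j$; (d) the set of supports of minimal zeros of $A$ is $\{I_1,\dots,I_n\}$, and the minimal zeros of $A$ are exactly the positive multiples of $u^1,\dots,u^n$; (e) if $n$ is even, $A$ is the sum of an exceptional copositive matrix with non-minimal circulant zero support set and a positive semi-definite matrix of rank $1$; (f) if $n$ is odd and $-1$ is not an eigenvalue of $\mathfrak M$, then $A$ is extremal. (ii) (a) $A$ has non-minimal circulant zero support set; (b) $B$ has corank $1$; (c) $A_{I_j}$ has corank $2$ for every $j$; (d) the support of every minimal zero of $A$ is a strict subset of some $I_j$, and every $I_j$ has exactly two subsets that are supports of minimal zeros of $A$; (e) every non-minimal zero of $A$ has support equal to some $I_j$ and is a sum of two minimal zeros of $A$; (f) $A$ is extremal. -/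

import Mathlib

open Matrix

/-! Copositive matrices and their zeros. -/

/-- `A` belongs to the cone of real symmetric copositive matrices. -/
def IsCopositive {n : ℕ} (A : Matrix (Fin n) (Fin n) ℝ) : Prop :=
  A.IsSymm ∧ ∀ x : Fin n → ℝ, 0 ≤ x → 0 ≤ x ⬝ᵥ (A *ᵥ x)

/-- A copositive matrix is exceptional if it is not the sum of a positive semi-definite matrix
and a symmetric element-wise nonnegative matrix. -/
def IsExceptional {n : ℕ} (A : Matrix (Fin n) (Fin n) ℝ) : Prop :=
  IsCopositive A ∧
    ¬ ∃ P N : Matrix (Fin n) (Fin n) ℝ,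
      P.PosSemidef ∧ N.IsSymm ∧ (∀ i j, 0 ≤ N i j) ∧ A = P + N

/-- `A` generates an extreme ray of the copositive cone. -/
def IsExtremalCopositive {n : ℕ} (A : Matrix (Fin n) (Fin n) ℝ) : Prop :=
  IsCopositive A ∧ A ≠ 0 ∧
    ∀ B C : Matrix (Fin n) (Fin n) ℝ, IsCopositive B → IsCopositive C → A = B + C →
      ∃ b c : ℝ, 0 ≤ b ∧ 0 ≤ c ∧ B = b • A ∧ C = c • A

/-- `v` is a zero of the copositive matrix `A`.  Since `v` is nonnegative, its support
(the set of its positive entries) is `Function.support v`. -/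
def IsZeroOf {n : ℕ} (A : Matrix (Fin n) (Fin n) ℝ) (v : Fin n → ℝ) : Prop :=
  v ≠ 0 ∧ 0 ≤ v ∧ v ⬝ᵥ (A *ᵥ v) = 0

/-- A zero is minimal if no other zero has strictly smaller support. -/
def IsMinimalZeroOf {n : ℕ} (A : Matrix (Fin n) (Fin n) ℝ) (v : Fin n → ℝ) : Prop :=
  IsZeroOf A v ∧
    ¬ ∃ w : Fin n → ℝ, IsZeroOf A w ∧ Function.support w ⊂ Function.support v

/-- The minimal zero support set of `A`. -/
def minimalZeroSupports {n : ℕ} (A : Matrix (Fin n) (Fin n) ℝ) : Set (Set (Fin n)) :=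
  {S | ∃ v : Fin n → ℝ, IsMinimalZeroOf A v ∧ Function.support v = S}

/-- The corank (dimension of the kernel) of a square matrix. -/
noncomputable def matrixCorank {m : ℕ} (M : Matrix (Fin m) (Fin m) ℝ) : ℕ :=
  Module.finrank ℝ (LinearMap.ker M.mulVecLin)

/-! The circular arcs `I_j` and collections of vectors supported on them.  Indices are counted
from `0`, and are read modulo `n`. -/

/-- The ordered index set `I_j = (j, j + 1, …, j + n - 3)` (indices modulo `n`). -/
def arc (n : ℕ) [NeZero n] (j : Fin n) (i : Fin (n - 2)) : Fin n :=
  Fin.ofNat n ((j : ℕ) + (i : ℕ))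

/-- The index set `I_j` without its order. -/
def arcSet (n : ℕ) [NeZero n] (j : Fin n) : Set (Fin n) :=
  Set.range (arc n j)

/-- The vectors `u^j` are nonnegative with support `I_j`. -/
def HasCirculantSupports {n : ℕ} [NeZero n] (u : Fin n → Fin n → ℝ) : Prop :=
  ∀ j, 0 ≤ u j ∧ Function.support (u j) = arcSet n j

/-- The principal submatrix `A_{I_j}`. -/
def arcSubmatrix {n : ℕ} [NeZero n] (A : Matrix (Fin n) (Fin n) ℝ) (j : Fin n) :
    Matrix (Fin (n - 2)) (Fin (n - 2)) ℝ :=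
  A.submatrix (arc n j) (arc n j)

/-- The face `F_u` of the copositive cone. -/
def copositiveFace {n : ℕ} (u : Fin n → Fin n → ℝ) : Set (Matrix (Fin n) (Fin n) ℝ) :=
  {A | IsCopositive A ∧ ∀ j, u j ⬝ᵥ (A *ᵥ u j) = 0}

/-- `A` is exceptional, has zeros `u^j` with supports `I_j`, and every zero of `A` is
proportional to one of them. -/
def HasMinimalCirculantZeroSupport {n : ℕ} [NeZero n] (A : Matrix (Fin n) (Fin n) ℝ) : Prop :=
  IsExceptional A ∧ ∃ u : Fin n → Fin n → ℝ, HasCirculantSupports u ∧ (∀ j, IsZeroOf A (u j)) ∧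
    ∀ v, IsZeroOf A v → ∃ (j : Fin n) (c : ℝ), v = c • u j

/-- `A` is exceptional, has zeros `u^j` with supports `I_j`, and some zero of `A` is
proportional to none of them. -/
def HasNonMinimalCirculantZeroSupport {n : ℕ} [NeZero n] (A : Matrix (Fin n) (Fin n) ℝ) : Prop :=
  IsExceptional A ∧ ∃ u : Fin n → Fin n → ℝ, HasCirculantSupports u ∧ (∀ j, IsZeroOf A (u j)) ∧
    ¬ ∀ v, IsZeroOf A v → ∃ (j : Fin n) (c : ℝ), v = c • u j

/-! The linear periodic system of order `d = n - 3` and period `n` attached to `u`. -/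

/-- The space of solutions `x = (x_0, x_1, …)` of `∑_{i = 0}^{d} u^t_{t + i} x_{t + i} = 0`,
`t ≥ 0`, where the indices of `u` are read modulo `n`. -/
def solutionSpace {n : ℕ} [NeZero n] (u : Fin n → Fin n → ℝ) : Submodule ℝ (ℕ → ℝ) where
  carrier := {x | ∀ t : ℕ,
    ∑ i : Fin (n - 2), u (Fin.ofNat n t) (arc n (Fin.ofNat n t) i) * x (t + i) = 0}
  add_mem' := by
    intro x y hx hy t
    have h1 := hx t
    have h2 := hy t
    simp only [Pi.add_apply, mul_add, Finset.sum_add_distrib]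
    rw [h1, h2, add_zero]
  zero_mem' := by
    intro t
    simp
  smul_mem' := by
    intro c x hx t
    have h1 := hx t
    simp only [Pi.smul_apply, smul_eq_mul, mul_left_comm _ c, ← Finset.mul_sum]
    rw [h1, mul_zero]

/-- The monodromy operator `(x_t) ↦ (x_{t + n})` on the solution space. -/
def monodromy {n : ℕ} [NeZero n] (u : Fin n → Fin n → ℝ) :
    Module.End ℝ (solutionSpace u) where
  toFun x := ⟨fun t => (x : ℕ → ℝ) (t + n), by
    intro t
    have h := x.2 (t + n)
    have e : Fin.ofNat n (t + n) = Fin.ofNat n t := by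
      apply Fin.ext
      simp [Fin.ofNat]
    rw [e] at h
    rw [← h]
    refine Finset.sum_congr rfl fun i _ => ?_
    change _ * (x : ℕ → ℝ) (t + i + n) = _
    rw [show t + (i : ℕ) + n = t + n + i by omega]⟩
  map_add' _ _ := rfl
  map_smul' _ _ := rfl

/-- The evaluation functional `e_t : x ↦ x_t`. -/
def evalAt {n : ℕ} [NeZero n] (u : Fin n → Fin n → ℝ) (t : ℕ) :
    Module.Dual ℝ (solutionSpace u) :=
  (LinearMap.proj t : (ℕ → ℝ) →ₗ[ℝ] ℝ) ∘ₗ (solutionSpace u).subtype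

/-- The map taking a solution to its initial values `(x_0, …, x_{d - 1})`. -/
def initialValues {n : ℕ} [NeZero n] (u : Fin n → Fin n → ℝ) :
    solutionSpace u →ₗ[ℝ] (Fin (n - 3) → ℝ) :=
  LinearMap.pi fun i => evalAt u i

/-- The sequence with the initial values `a` generated by the recursion. -/
noncomputable def generate {n : ℕ} [NeZero n] (u : Fin n → Fin n → ℝ) (a : Fin (n - 3) → ℝ) :
    ℕ → ℝ
  | t =>
    if h : t < n - 3 then a ⟨t, h⟩
    else
      let j : Fin n := Fin.ofNat n (t - (n - 3))
      (-∑ i : Fin (n - 3), u j (Fin.ofNat n (j + i)) * generate u a (t - (n - 3) + i))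
        / u j (Fin.ofNat n (j + (n - 3)))
  decreasing_by omega

theorem solution_eq_iff {n : ℕ} [NeZero n] (hn : 5 ≤ n) (u : Fin n → Fin n → ℝ) (x : ℕ → ℝ)
    (t : ℕ) :
    (∑ i : Fin (n - 2), u (Fin.ofNat n t) (arc n (Fin.ofNat n t) i) * x (t + i)) =
      (∑ i : Fin (n - 3), u (Fin.ofNat n t) (Fin.ofNat n ((Fin.ofNat n t : Fin n) + i))
        * x (t + i)) +
      u (Fin.ofNat n t) (Fin.ofNat n ((Fin.ofNat n t : Fin n) + (n - 3))) * x (t + (n - 3)) := by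
  have key : ∀ (m : ℕ) (f : ℕ → ℝ), m = (n - 3) + 1 →
      ∑ i : Fin m, f i = (∑ i : Fin (n - 3), f i) + f (n - 3) := by
    intro m f hm
    subst hm
    rw [Fin.sum_univ_castSucc]
    simp
  exact key (n - 2) (fun i => u (Fin.ofNat n t)
    (Fin.ofNat n ((Fin.ofNat n t : Fin n) + i)) * x (t + i)) (by omega)

theorem leading_ne_zero {n : ℕ} [NeZero n] (hn : 5 ≤ n) {u : Fin n → Fin n → ℝ}
    (hu : HasCirculantSupports u) (j : Fin n) : u j (Fin.ofNat n (j + (n - 3))) ≠ 0 := by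
  have h : Fin.ofNat n ((j : ℕ) + (n - 3)) ∈ Function.support (u j) := by
    rw [(hu j).2]
    exact ⟨⟨n - 3, by omega⟩, rfl⟩
  exact h

theorem initialValues_bijective {n : ℕ} [NeZero n] (hn : 5 ≤ n) {u : Fin n → Fin n → ℝ}
    (hu : HasCirculantSupports u) : Function.Bijective (initialValues u) := by
  constructor
  · rw [injective_iff_map_eq_zero]
    intro x hx
    apply Subtype.ext
    funext t
    induction t using Nat.strong_induction_on with
    | _ t ih =>
      by_cases h : t < n - 3
      · exact congrFun hx ⟨t, h⟩
      · have h1 := x.2 (t - (n - 3))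
        rw [solution_eq_iff hn, Finset.sum_eq_zero, zero_add,
          show t - (n - 3) + (n - 3) = t by omega] at h1
        · exact (mul_eq_zero.1 h1).resolve_left (leading_ne_zero hn hu _)
        · intro i _
          rw [ih _ (by omega)]
          simp
  · intro a
    refine ⟨⟨generate u a, ?_⟩, ?_⟩
    · intro t
      rw [solution_eq_iff hn]
      have h1 := generate.eq_def u a (t + (n - 3))
      rw [dif_neg (by omega), show t + (n - 3) - (n - 3) = t by omega] at h1
      rw [h1]
      have h2 := leading_ne_zero hn hu (Fin.ofNat n t)
      dsimp only
      rw [mul_div_cancel₀ _ h2]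
      ring
    · funext i
      change generate u a i = a i
      rw [generate, dif_pos i.2]

/-- The basis of the solution space dual to the evaluation functionals `e_0, …, e_{d - 1}`. -/
noncomputable def solutionBasis {n : ℕ} [NeZero n] (hn : 5 ≤ n) {u : Fin n → Fin n → ℝ}
    (hu : HasCirculantSupports u) : Module.Basis (Fin (n - 3)) ℝ (solutionSpace u) :=
  Module.Basis.ofEquivFun
    (LinearEquiv.ofBijective (initialValues u) (initialValues_bijective hn hu))

/-- The basis `e_0, …, e_{d - 1}` of the dual of the solution space. -/
noncomputable def evalBasis {n : ℕ} [NeZero n] (hn : 5 ≤ n) {u : Fin n → Fin n → ℝ}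
    (hu : HasCirculantSupports u) :
    Module.Basis (Fin (n - 3)) ℝ (Module.Dual ℝ (solutionSpace u)) :=
  (solutionBasis hn hu).dualBasis

theorem evalBasis_apply {n : ℕ} [NeZero n] (hn : 5 ≤ n) {u : Fin n → Fin n → ℝ}
    (hu : HasCirculantSupports u) (t : Fin (n - 3)) : evalBasis hn hu t = evalAt u t := by
  ext x
  simp [evalBasis, solutionBasis, initialValues]

/-! The correspondence between matrices and bilinear forms. -/

/-- The space `𝒜_u` of symmetric matrices with `A_{I_j} u^j_{I_j} = 0` for all `j`. -/
def matrixSpace {n : ℕ} [NeZero n] (u : Fin n → Fin n → ℝ) :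
    Submodule ℝ (Matrix (Fin n) (Fin n) ℝ) where
  carrier := {A | A.IsSymm ∧ ∀ j, arcSubmatrix A j *ᵥ (u j ∘ arc n j) = 0}
  add_mem' := by
    rintro A B ⟨hA, hA'⟩ ⟨hB, hB'⟩
    refine ⟨hA.add hB, fun j => ?_⟩
    have : arcSubmatrix (A + B) j = arcSubmatrix A j + arcSubmatrix B j := rfl
    rw [this, Matrix.add_mulVec, hA' j, hB' j, add_zero]
  zero_mem' := by
    refine ⟨Matrix.isSymm_zero, fun j => ?_⟩
    have : arcSubmatrix (0 : Matrix (Fin n) (Fin n) ℝ) j = 0 := rfl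
    rw [this, Matrix.zero_mulVec]
  smul_mem' := by
    rintro c A ⟨hA, hA'⟩
    refine ⟨hA.smul c, fun j => ?_⟩
    have : arcSubmatrix (c • A) j = c • arcSubmatrix A j := rfl
    rw [this, Matrix.smul_mulVec, hA' j, smul_zero]

/-- The linear map `Λ` taking `A ∈ 𝒜_u` to the bilinear form `B` on the dual of the solution space
with `B(e_t, e_s) = A_{ts}` for `t, s = 0, …, d - 1`. -/
noncomputable def formOfMatrix {n : ℕ} [NeZero n] (hn : 5 ≤ n) {u : Fin n → Fin n → ℝ}
    (hu : HasCirculantSupports u) :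
    matrixSpace u →ₗ[ℝ] LinearMap.BilinForm ℝ (Module.Dual ℝ (solutionSpace u)) where
  toFun A := Matrix.toBilin (evalBasis hn hu)
    ((A : Matrix (Fin n) (Fin n) ℝ).submatrix
      (fun t : Fin (n - 3) => Fin.ofNat n t) (fun t : Fin (n - 3) => Fin.ofNat n t))
  map_add' A B := by
    rw [← map_add]
    rfl
  map_smul' c A := by
    rw [RingHom.id_apply, ← map_smul]
    rfl

theorem formOfMatrix_evalAt {n : ℕ} [NeZero n] (hn : 5 ≤ n) {u : Fin n → Fin n → ℝ}
    (hu : HasCirculantSupports u) (A : matrixSpace u) (t s : Fin (n - 3)) :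
    formOfMatrix hn hu A (evalAt u t) (evalAt u s) =
      (A : Matrix (Fin n) (Fin n) ℝ) (Fin.ofNat n t) (Fin.ofNat n s) := by
  rw [← evalBasis_apply hn hu, ← evalBasis_apply hn hu]
  simp [formOfMatrix, Matrix.toBilin_apply, Finsupp.single_apply]

/-- A positive definite symmetric bilinear form. -/
def IsPosDefForm {V : Type*} [AddCommGroup V] [Module ℝ V] (B : LinearMap.BilinForm ℝ V) : Prop :=
  B.IsSymm ∧ ∀ w : V, w ≠ 0 → 0 < B w w

/-- The corank of a bilinear form: the dimension of `{w | ∀ w', B(w, w') = 0}`. -/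
noncomputable def formCorank {V : Type*} [AddCommGroup V] [Module ℝ V]
    (B : LinearMap.BilinForm ℝ V) : ℕ :=
  Module.finrank ℝ (LinearMap.ker B)

/-! The two cases. -/

/-- The properties of the case of a minimal circulant zero support set. -/
structure MinimalCase {n : ℕ} [NeZero n] (u : Fin n → Fin n → ℝ) (A : Matrix (Fin n) (Fin n) ℝ)
    (B : LinearMap.BilinForm ℝ (Module.Dual ℝ (solutionSpace u))) : Prop where
  minimal_support : HasMinimalCirculantZeroSupport A
  posDef : IsPosDefForm B
  corank_submatrix : ∀ j, matrixCorank (arcSubmatrix A j) = 1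
  minimal_zero_supports : minimalZeroSupports A = Set.range (arcSet n)
  minimal_zeros : ∀ v, IsMinimalZeroOf A v ↔ ∃ (j : Fin n) (c : ℝ), 0 < c ∧ v = c • u j
  even_decomposition : Even n → ∃ A' P : Matrix (Fin n) (Fin n) ℝ,
    HasNonMinimalCirculantZeroSupport A' ∧ P.PosSemidef ∧ P.rank = 1 ∧ A = A' + P
  odd_extremal : Odd n → ¬ (monodromy u).HasEigenvalue (-1) → IsExtremalCopositive A

/-- The properties of the case of a non-minimal circulant zero support set. -/
structure NonMinimalCase {n : ℕ} [NeZero n] (u : Fin n → Fin n → ℝ)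
    (A : Matrix (Fin n) (Fin n) ℝ)
    (B : LinearMap.BilinForm ℝ (Module.Dual ℝ (solutionSpace u))) : Prop where
  nonminimal_support : HasNonMinimalCirculantZeroSupport A
  corank_form : formCorank B = 1
  corank_submatrix : ∀ j, matrixCorank (arcSubmatrix A j) = 2
  minimal_zeros_strict : ∀ v, IsMinimalZeroOf A v → ∃ j, Function.support v ⊂ arcSet n j
  two_minimal_supports : ∀ j, {S ∈ minimalZeroSupports A | S ⊆ arcSet n j}.ncard = 2
  nonminimal_zeros : ∀ v, IsZeroOf A v → ¬ IsMinimalZeroOf A v →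
    (∃ j, Function.support v = arcSet n j) ∧
      ∃ v₁ v₂, IsMinimalZeroOf A v₁ ∧ IsMinimalZeroOf A v₂ ∧ v = v₁ + v₂
  extremal : IsExtremalCopositive A

/-! Copositive matrices: first and second order conditions at a zero. -/

section General

variable {n : ℕ} {A : Matrix (Fin n) (Fin n) ℝ}

/-! The recursion defining `solutionSpace u` says that `u^t` is the coefficient vector of a linear
relation among the `n - 2` functionals `e_t, …, e_{t+n-3}`, and any `n - 3` consecutive functionals
form a basis of the dual. The condition `A_{I_t} u^t_{I_t} = 0` is the same relation among rows of
`A`. Hence the form `B` agrees with `A` on every window of length `n - 2` (`form_evalAt`), and it is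
invariant under the dual of the monodromy because `A` is periodic (`form_dualMap`). Only pairs of
indices at cyclic distance two, read the long way round, see a difference, the number `formDefect`.
On the hyperplane `x_{t-1} = 0` the quadratic form of `A` is thus `B(w, w)` plus `2 x_t x_{t-2}`
times the defect (`quadratic_eq_form_add`). Copositivity of a member of the face makes `B` positive
semi-definite and the defects nonnegative, and the converse is `isCopositive_of_form_nonneg`;
exceptionality makes the defects strictly positive (`IsExceptional.mulVec_pos`).

Positive defects control the zeros of `A`. Each zero is supported in an arc and is nonzero at all
interior places of it, so a kernel vector of `A_{I_t}` is determined by its two end entries and the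
kernel has dimension at most 2. This dimension is also the corank of `B` plus 1
(`finrank_arcKernel`), so the corank of `B` is 0 or 1, and these are the two cases.

If the corank is 1, the end entries are arbitrary, and the kernel vectors with one vanishing end are
the minimal zeros. The image under `A` of such a zero has a single nonzero entry, which forces
extremality.

If the corank is 0, `B` is definite, and multiples of any other member of the face can be subtracted
from `A` until the form degenerates or exceptionality is lost. For even `n`, the monodromy preserves
a definite form and the orientation of a space of odd dimension, so it has the eigenvalue 1; a
periodic solution `y` then gives the rank one matrix to subtract. For odd `n`, the kernel of a
degenerate exceptional form would be an eigenspace with eigenvalue `-1`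
(`IsExceptional.hasEigenvalue_neg_one`). When `-1` is not an eigenvalue, no degenerate exceptional
form exists in the face, and every summand of `A` is proportional to `A`. -/

theorem dotProduct_mulVec_symm (hA : A.IsSymm) (x y : Fin n → ℝ) :
    x ⬝ᵥ (A *ᵥ y) = y ⬝ᵥ (A *ᵥ x) := by
  rw [dotProduct_mulVec, ← mulVec_transpose, hA.eq, dotProduct_comm]

theorem quadratic_add_smul (hA : A.IsSymm) (x y : Fin n → ℝ) (t : ℝ) :
    (x + t • y) ⬝ᵥ (A *ᵥ (x + t • y)) =
      x ⬝ᵥ (A *ᵥ x) + 2 * t * (y ⬝ᵥ (A *ᵥ x)) + t ^ 2 * (y ⬝ᵥ (A *ᵥ y)) := by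
  simp only [mulVec_add, mulVec_smul, dotProduct_add, add_dotProduct, dotProduct_smul,
    smul_dotProduct, smul_eq_mul]
  rw [dotProduct_mulVec_symm hA x y]
  ring

theorem nonneg_of_forall_quadratic_nonneg {a b : ℝ}
    (h : ∀ t : ℝ, 0 < t → 0 ≤ 2 * t * a + t ^ 2 * b) : 0 ≤ a := by
  by_contra ha
  push Not at ha
  have hb : 0 < |b| + 1 := by positivity
  -- This `t` satisfies `t * |b| < -a`, so the factor `2 * a + t * b` would be negative.
  have ht : 0 < -a / (|b| + 1) := div_pos (by linarith) hb
  have h1 := h _ ht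
  set t := -a / (|b| + 1) with ht'
  have h2 : t * (|b| + 1) = -a := by rw [ht']; field_simp
  have h3 : 0 ≤ t * (2 * a + t * b) := by
    rwa [show t * (2 * a + t * b) = 2 * t * a + t ^ 2 * b by ring]
  have h4 : 0 ≤ 2 * a + t * b := nonneg_of_mul_nonneg_right h3 ht
  have h5 : t * b ≤ t * |b| := mul_le_mul_of_nonneg_left (le_abs_self b) ht.le
  nlinarith

/-- A zero minimises the quadratic form on the orthant, so the derivative in a feasible direction is
nonnegative. -/
theorem IsZeroOf.dotProduct_nonneg (hA : IsCopositive A) {v : Fin n → ℝ} (hv : IsZeroOf A v)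
    {y : Fin n → ℝ} (hy : 0 ≤ y) : 0 ≤ y ⬝ᵥ (A *ᵥ v) := by
  refine nonneg_of_forall_quadratic_nonneg (b := y ⬝ᵥ (A *ᵥ y)) fun t ht => ?_
  have h := hA.2 (v + t • y) (add_nonneg hv.2.1 (smul_nonneg ht.le hy))
  rw [quadratic_add_smul hA.1, hv.2.2] at h
  linarith

theorem IsZeroOf.mulVec_nonneg (hA : IsCopositive A) {v : Fin n → ℝ} (hv : IsZeroOf A v) :
    0 ≤ A *ᵥ v := by
  intro k
  have h := hv.dotProduct_nonneg hA (y := Pi.single k 1) (by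
    intro i
    by_cases h : i = k
    · subst h; simp
    · simp [h])
  simpa using h

theorem IsZeroOf.mulVec_eq_zero (hA : IsCopositive A) {v : Fin n → ℝ} (hv : IsZeroOf A v)
    {k : Fin n} (hk : v k ≠ 0) : (A *ᵥ v) k = 0 := by
  have h := hv.2.2
  rw [dotProduct, Finset.sum_eq_zero_iff_of_nonneg
    (fun i _ => mul_nonneg (hv.2.1 i) (hv.mulVec_nonneg hA i))] at h
  exact (mul_eq_zero.1 (h k (Finset.mem_univ _))).resolve_left hk

theorem exists_pos_add_smul_nonneg {v y : Fin n → ℝ} (hv : 0 ≤ v)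
    (hy : ∀ i, v i = 0 → 0 ≤ y i) : ∃ t : ℝ, 0 < t ∧ 0 ≤ v + t • y := by
  have h : ∀ᶠ t : ℝ in nhdsWithin 0 (Set.Ioi 0), ∀ i, 0 ≤ v i + t * y i := by
    rw [Filter.eventually_all]
    intro i
    by_cases hi : v i = 0
    · filter_upwards [self_mem_nhdsWithin] with t ht
      rw [hi, zero_add]
      exact mul_nonneg (le_of_lt ht) (hy i hi)
    · have h0 : 0 < v i := lt_of_le_of_ne (hv i) (Ne.symm hi)
      have hc : Continuous fun t : ℝ => v i + t * y i := by fun_prop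
      have h1 : ∀ᶠ t : ℝ in nhds 0, 0 < v i + t * y i :=
        hc.continuousAt.eventually_const_lt (by simpa using h0)
      exact (h1.filter_mono nhdsWithin_le_nhds).mono fun t ht => ht.le
  obtain ⟨t, ht, ht'⟩ := (h.and self_mem_nhdsWithin).exists
  exact ⟨t, ht', fun i => by simpa using ht i⟩

/-- The point `v + t • y` is in the orthant for small `t > 0`, and the terms of order 0 and 1 vanish
there. -/
theorem IsZeroOf.second_order (hA : IsCopositive A) {v : Fin n → ℝ} (hv : IsZeroOf A v)
    {y : Fin n → ℝ} (hy : ∀ i, v i = 0 → 0 ≤ y i) (h0 : y ⬝ᵥ (A *ᵥ v) = 0) :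
    0 ≤ y ⬝ᵥ (A *ᵥ y) := by
  obtain ⟨t, ht, hvy⟩ := exists_pos_add_smul_nonneg hv.2.1 hy
  have h := hA.2 _ hvy
  rw [quadratic_add_smul hA.1, hv.2.2, h0, mul_zero, zero_add, zero_add] at h
  exact nonneg_of_mul_nonneg_right h (by positivity)

theorem IsZeroOf.dotProduct_eq_zero (hA : IsCopositive A) {v : Fin n → ℝ} (hv : IsZeroOf A v)
    {y : Fin n → ℝ} (hy : ∀ i, v i = 0 → y i = 0 ∨ (A *ᵥ v) i = 0) : y ⬝ᵥ (A *ᵥ v) = 0 := by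
  refine Finset.sum_eq_zero fun i _ => ?_
  by_cases hi : v i = 0
  · rcases hy i hi with h | h <;> simp [h]
  · rw [hv.mulVec_eq_zero hA hi, mul_zero]

/-- If the support of the zero `w` is contained in that of the zero `v`, then `A w` vanishes on
the support of `v`. -/
theorem IsZeroOf.mulVec_eq_zero_of_support (hA : IsCopositive A) {v w : Fin n → ℝ}
    (hv : IsZeroOf A v) (hw : IsZeroOf A w) (h : ∀ i, v i = 0 → w i = 0) {k : Fin n}
    (hk : v k ≠ 0) : (A *ᵥ w) k = 0 := by
  have h0 : v ⬝ᵥ (A *ᵥ w) = 0 := by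
    rw [dotProduct_mulVec_symm hA.1]
    exact hv.dotProduct_eq_zero hA fun i hi => Or.inl (h i hi)
  rw [dotProduct, Finset.sum_eq_zero_iff_of_nonneg
    (fun i _ => mul_nonneg (hv.2.1 i) (hw.mulVec_nonneg hA i))] at h0
  exact (mul_eq_zero.1 (h0 k (Finset.mem_univ _))).resolve_left hk

theorem posSemidef_of_quadratic_nonneg (hA : A.IsSymm) (h : ∀ x, 0 ≤ x ⬝ᵥ (A *ᵥ x)) :
    A.PosSemidef :=
  .of_dotProduct_mulVec_nonneg (by rwa [IsHermitian, conjTranspose_eq_transpose_of_trivial])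
    (by simpa using h)

theorem Matrix.PosSemidef.isSymm_real (hA : A.PosSemidef) : A.IsSymm := by
  have := hA.isHermitian
  rwa [IsHermitian, conjTranspose_eq_transpose_of_trivial] at this

theorem Matrix.PosSemidef.quadratic_nonneg (hA : A.PosSemidef) (x : Fin n → ℝ) :
    0 ≤ x ⬝ᵥ (A *ᵥ x) := by
  simpa using hA.dotProduct_mulVec_nonneg x

theorem Matrix.PosSemidef.isCopositive (hA : A.PosSemidef) : IsCopositive A :=
  ⟨hA.isSymm_real, fun x _ => hA.quadratic_nonneg x⟩

theorem IsExceptional.exists_quadratic_neg (hA : IsExceptional A) :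
    ∃ x, x ⬝ᵥ (A *ᵥ x) < 0 := by
  by_contra h
  push Not at h
  exact hA.2 ⟨A, 0, posSemidef_of_quadratic_nonneg hA.1.1 h, isSymm_zero, by simp, by simp⟩

/-- If `A` is nonnegative on a coordinate hyperplane and has a zero outside of it, then `A` is the
sum of a positive semi-definite and a nonnegative matrix. -/
theorem exists_posSemidef_add_nonneg (hA : A.IsSymm) {v : Fin n → ℝ} (hv : 0 ≤ v)
    (hv0 : v ⬝ᵥ (A *ᵥ v) = 0) (hAv : 0 ≤ A *ᵥ v) {m : Fin n} (hm : 0 < v m)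
    (hpos : ∀ x : Fin n → ℝ, x m = 0 → 0 ≤ x ⬝ᵥ (A *ᵥ x)) :
    ∃ P N : Matrix (Fin n) (Fin n) ℝ,
      P.PosSemidef ∧ N.IsSymm ∧ (∀ i j, 0 ≤ N i j) ∧ A = P + N := by
  have hAm : (A *ᵥ v) m = 0 := by
    rw [dotProduct, Finset.sum_eq_zero_iff_of_nonneg
      (fun i _ => mul_nonneg (hv i) (hAv i))] at hv0
    exact (mul_eq_zero.1 (hv0 m (Finset.mem_univ _))).resolve_left hm.ne'
  set s : Fin n → ℝ := (v m)⁻¹ • (A *ᵥ v) with hs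
  have hs0 : 0 ≤ s := smul_nonneg (inv_nonneg.2 hm.le) hAv
  have hsm : s m = 0 := by simp [hs, hAm]
  have hsv : s ⬝ᵥ v = 0 := by rw [hs, smul_dotProduct, dotProduct_comm, hv0, smul_zero]
  set e : Fin n → ℝ := Pi.single m 1 with he
  -- Since `s ⬝ᵥ v = 0`, this `N` is made so that `(A - N) *ᵥ v = 0`, while its quadratic form `2
  -- x_m (s ⬝ᵥ x)` vanishes on `x m = 0`.
  set N : Matrix (Fin n) (Fin n) ℝ := vecMulVec s e + vecMulVec e s with hN
  have hNs : N.IsSymm := by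
    rw [Matrix.IsSymm, hN, transpose_add, transpose_vecMulVec, transpose_vecMulVec, add_comm]
  have hNmul : ∀ x, N *ᵥ x = (x m) • s + (s ⬝ᵥ x) • e := by
    intro x
    rw [hN, add_mulVec, vecMulVec_mulVec, vecMulVec_mulVec]
    simp [he]
  have he0 : 0 ≤ e := by
    intro i
    rw [he]
    by_cases h : i = m
    · subst h; simp
    · simp [h]
  have hsym : (A - N).IsSymm := hA.sub hNs
  have hker : (A - N) *ᵥ v = 0 := by
    rw [sub_mulVec, hNmul, hsv, zero_smul, add_zero, hs, smul_smul, mul_inv_cancel₀ hm.ne',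
      one_smul, sub_self]
  refine ⟨A - N, N, posSemidef_of_quadratic_nonneg hsym fun x => ?_, hNs, fun i j => ?_, by simp⟩
  -- Moving along the kernel vector `v` brings any point to the hyperplane `x m = 0`, where `A - N`
  -- and `A` have the same quadratic form.
  · set y := x - (x m / v m) • v with hy
    have hym : y m = 0 := by simp [hy, hm.ne']
    have hx : x = y + (x m / v m) • v := by simp [hy]
    have e1 : v ⬝ᵥ ((A - N) *ᵥ y) = 0 := by
      rw [dotProduct_mulVec_symm hsym, hker, dotProduct_zero]
    have h1 : x ⬝ᵥ ((A - N) *ᵥ x) = y ⬝ᵥ (A *ᵥ y) := by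
      rw [hx, quadratic_add_smul hsym, e1, hker, dotProduct_zero, mul_zero, mul_zero,
        add_zero, add_zero, sub_mulVec, hNmul, hym, zero_smul, zero_add, dotProduct_sub,
        dotProduct_smul]
      simp [he, hym]
    rw [h1]
    exact hpos y hym
  · rw [hN]
    exact add_nonneg (mul_nonneg (hs0 i) (he0 j)) (mul_nonneg (he0 i) (hs0 j))

theorem IsCopositive.exists_quadratic_pos (hA : IsCopositive A) (h0 : A ≠ 0) :
    ∃ x, 0 ≤ x ∧ 0 < x ⬝ᵥ (A *ᵥ x) := by
  by_contra h
  push Not at h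
  have h1 : ∀ x, 0 ≤ x → x ⬝ᵥ (A *ᵥ x) = 0 := fun x hx => le_antisymm (h x hx) (hA.2 x hx)
  have hs : ∀ k : Fin n, (0 : Fin n → ℝ) ≤ Pi.single k 1 := by
    intro k i
    by_cases h : i = k
    · subst h; simp
    · simp [h]
  apply h0
  ext i j
  have h2 := h1 (Pi.single i 1 + (1 : ℝ) • Pi.single j 1) (add_nonneg (hs i) (by simp [hs j]))
  rw [quadratic_add_smul hA.1, h1 _ (hs i), h1 _ (hs j), dotProduct_mulVec_symm hA.1] at h2
  simpa using h2

theorem IsCopositive.coeff_nonneg_of_smul (hA : IsCopositive A) (h0 : A ≠ 0) {c : ℝ}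
    (hc : IsCopositive (c • A)) : 0 ≤ c := by
  obtain ⟨x, hx, hx'⟩ := hA.exists_quadratic_pos h0
  have h := hc.2 x hx
  rw [smul_mulVec, dotProduct_smul, smul_eq_mul] at h
  exact nonneg_of_mul_nonneg_left h hx'

theorem exists_add_smul_boundary {v y : Fin n → ℝ} (hv : 0 ≤ v) (hy : ∃ i, y i < 0) :
    ∃ t : ℝ, 0 ≤ t ∧ 0 ≤ v + t • y ∧ ∃ i, y i < 0 ∧ v i + t * y i = 0 := by
  -- The least ratio `v i / -y i` over the decreasing coordinates is the moment when the ray reaches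
  -- the boundary of the orthant.
  obtain ⟨i, hi, hmin⟩ := Finset.exists_min_image (Finset.univ.filter fun i => y i < 0)
    (fun i => v i / -y i) (by
      obtain ⟨i, hi⟩ := hy
      exact ⟨i, by simpa using hi⟩)
  simp only [Finset.mem_filter, Finset.mem_univ, true_and] at hi hmin
  refine ⟨v i / -y i, div_nonneg (hv i) (by linarith), fun k => ?_, i, hi, ?_⟩
  · have ht : 0 ≤ v i / -y i := div_nonneg (hv i) (by linarith)
    rcases lt_or_ge (y k) 0 with hk | hk
    · have := hmin k hk
      rw [le_div_iff₀ (by linarith)] at this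
      simp only [Pi.zero_apply, Pi.add_apply, Pi.smul_apply, smul_eq_mul]
      linarith
    · exact add_nonneg (hv k) (mul_nonneg ht hk)
  · have : y i ≠ 0 := hi.ne
    field_simp
    ring

/-- The last copositive matrix on the ray from the copositive matrix `A` in the direction `-X`. -/
theorem IsCopositive.exists_maximal_sub_smul (hA : IsCopositive A) {X : Matrix (Fin n) (Fin n) ℝ}
    (hX : IsCopositive X) (h0 : X ≠ 0) :
    ∃ t : ℝ, IsCopositive (A - t • X) ∧ ∀ s, IsCopositive (A - s • X) → s ≤ t := by
  have hq : ∀ (s : ℝ) (x : Fin n → ℝ),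
      x ⬝ᵥ ((A - s • X) *ᵥ x) = x ⬝ᵥ (A *ᵥ x) - s * (x ⬝ᵥ (X *ᵥ x)) := by
    intro s x
    rw [sub_mulVec, smul_mulVec, dotProduct_sub, dotProduct_smul, smul_eq_mul]
  set S : Set ℝ := {s | IsCopositive (A - s • X)} with hS
  have hS0 : (0 : ℝ) ∈ S := by simpa [hS] using hA
  -- Copositivity of `A - s • X` for `s ≥ 0` amounts to these closed upper bounds on `s`, so the
  -- supremum is attained.
  have hle : ∀ x : Fin n → ℝ, 0 ≤ x → 0 < x ⬝ᵥ (X *ᵥ x) →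
      ∀ s ∈ S, s ≤ x ⬝ᵥ (A *ᵥ x) / x ⬝ᵥ (X *ᵥ x) := by
    intro x hx hx' s hs
    have := hs.2 x hx
    rw [hq] at this
    rw [le_div_iff₀ hx']
    linarith
  obtain ⟨x, hx, hx'⟩ := hX.exists_quadratic_pos h0
  refine ⟨sSup S, ⟨hA.1.sub (hX.1.smul _), fun y hy => ?_⟩,
    fun s hs => le_csSup ⟨_, fun s hs => hle x hx hx' s hs⟩ hs⟩
  rw [hq]
  rcases (hX.2 y hy).eq_or_lt with h | h
  · rw [← h, mul_zero, sub_zero]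
    exact hA.2 y hy
  · have := csSup_le ⟨0, hS0⟩ (hle y hy h)
    rw [le_div_iff₀ h] at this
    linarith

theorem IsExceptional.ne_zero (hexc : IsExceptional A) : A ≠ 0 := by
  obtain ⟨x, hx⟩ := hexc.exists_quadratic_neg
  rintro rfl
  simp at hx

theorem isExtremalCopositive_of_forall (hA : IsCopositive A) (h0 : A ≠ 0)
    (h : ∀ X C, IsCopositive X → IsCopositive C → A = X + C → ∃ d : ℝ, X = d • A) :
    IsExtremalCopositive A := by
  refine ⟨hA, h0, fun X C hX hC hXC => ?_⟩
  obtain ⟨d, hd⟩ := h X C hX hC hXC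
  have hd' : C = (1 - d) • A := by rw [sub_smul, one_smul, ← hd, hXC, add_sub_cancel_left]
  exact ⟨d, 1 - d, hA.coeff_nonneg_of_smul h0 (hd ▸ hX), hA.coeff_nonneg_of_smul h0 (hd' ▸ hC),
    hd, hd'⟩

theorem IsZeroOf.of_add_left {X C : Matrix (Fin n) (Fin n) ℝ} (hX : IsCopositive X)
    (hC : IsCopositive C) {v : Fin n → ℝ} (hv : IsZeroOf (X + C) v) : IsZeroOf X v := by
  refine ⟨hv.1, hv.2.1, ?_⟩
  have h := hv.2.2
  rw [add_mulVec, dotProduct_add] at h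
  have h1 := hX.2 v hv.2.1
  have h2 := hC.2 v hv.2.1
  linarith

theorem ne_zero_of_apply_eq_one {x : Fin n → ℝ} {k : Fin n} (h : x k = 1) : x ≠ 0 := by
  rintro rfl
  simp at h

theorem IsZeroOf.smul {v : Fin n → ℝ} (hv : IsZeroOf A v) {c : ℝ} (hc : 0 < c) :
    IsZeroOf A (c • v) :=
  ⟨smul_ne_zero hc.ne' hv.1, smul_nonneg hc.le hv.2.1, by
    rw [mulVec_smul, dotProduct_smul, smul_dotProduct, hv.2.2, smul_zero, smul_zero]⟩

end General

/-! Cyclic indices, arcs, and the face `F_u`. -/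

section Cyclic

variable {n : ℕ} [NeZero n]

theorem ofNat_add_period (t : ℕ) : Fin.ofNat n (t + n) = Fin.ofNat n t := by
  apply Fin.ext
  simp [Fin.ofNat]

theorem ofNat_val_eq (k : Fin n) : Fin.ofNat n (k : ℕ) = k := by
  apply Fin.ext
  simp [Fin.ofNat, Nat.mod_eq_of_lt k.2]

/-- Indices are counted from a base point `t` by an offset `i < n`: the arc starting at `t` is `i <
n - 2`, and the places `t - 2`, `t - 1` are written with offsets `n - 2`, `n - 1`. -/
theorem exists_eq_ofNat_add (k : Fin n) (t : ℕ) : ∃ i < n, k = Fin.ofNat n (t + i) := by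
  have hn : 0 < n := Nat.pos_of_ne_zero (NeZero.ne n)
  refine ⟨((k : ℕ) + (n - t % n)) % n, Nat.mod_lt _ hn, Fin.ext ?_⟩
  have h1 : t % n < n := Nat.mod_lt _ hn
  change (k : ℕ) = (t + ((k : ℕ) + (n - t % n)) % n) % n
  rw [Nat.add_mod_mod, ← Nat.mod_add_mod, show t % n + (k + (n - t % n)) = k + n by omega,
    Nat.add_mod_right, Nat.mod_eq_of_lt k.2]

theorem ofNat_add_inj {t i j : ℕ} (hi : i < n) (hj : j < n) :
    Fin.ofNat n (t + i) = Fin.ofNat n (t + j) ↔ i = j := by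
  constructor
  · intro h
    have h1 : t + i ≡ t + j [MOD n] := congrArg Fin.val h
    have h2 := Nat.ModEq.add_left_cancel' t h1
    rwa [Nat.ModEq, Nat.mod_eq_of_lt hi, Nat.mod_eq_of_lt hj] at h2
  · rintro rfl
    rfl

theorem arc_ofNat (t : ℕ) (i : Fin (n - 2)) : arc n (Fin.ofNat n t) i = Fin.ofNat n (t + i) := by
  apply Fin.ext
  simp [arc, Fin.ofNat]

theorem ofNat_add_mem_arcSet {t i : ℕ} (hi : i < n) :
    Fin.ofNat n (t + i) ∈ arcSet n (Fin.ofNat n t) ↔ i < n - 2 := by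
  constructor
  · rintro ⟨j, hj⟩
    rw [arc_ofNat, ofNat_add_inj (by omega) hi] at hj
    omega
  · intro h
    exact ⟨⟨i, h⟩, arc_ofNat t ⟨i, h⟩⟩

theorem sum_eq_sum_range_shift (f : Fin n → ℝ) (t : ℕ) :
    ∑ k, f k = ∑ i ∈ Finset.range n, f (Fin.ofNat n (t + i)) := by
  symm
  refine Finset.sum_nbij (fun i => Fin.ofNat n (t + i)) (by simp) ?_ ?_ (by simp)
  · intro i hi j hj h
    exact (ofNat_add_inj (by simpa using hi) (by simpa using hj)).1 h
  · intro k _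
    obtain ⟨i, hi, rfl⟩ := exists_eq_ofNat_add k t
    exact ⟨i, by simpa using hi, rfl⟩

theorem sum_eq_sum_range_pred (hn : 5 ≤ n) (f : Fin n → ℝ) (t : ℕ)
    (h : f (Fin.ofNat n (t + (n - 1))) = 0) :
    ∑ k, f k = ∑ i ∈ Finset.range (n - 1), f (Fin.ofNat n (t + i)) := by
  have key : ∀ m, m = n - 1 + 1 → ∑ i ∈ Finset.range m, f (Fin.ofNat n (t + i)) =
      ∑ i ∈ Finset.range (n - 1), f (Fin.ofNat n (t + i)) := by
    rintro m rfl
    rw [Finset.sum_range_succ, h, add_zero]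
  rw [sum_eq_sum_range_shift f t, key n (by omega)]

theorem sum_eq_sum_range_arc (hn : 5 ≤ n) (f : Fin n → ℝ) (t : ℕ)
    (h : f (Fin.ofNat n (t + (n - 2))) = 0) (h' : f (Fin.ofNat n (t + (n - 1))) = 0) :
    ∑ k, f k = ∑ i ∈ Finset.range (n - 2), f (Fin.ofNat n (t + i)) := by
  have key : ∀ m, m = n - 2 + 1 → ∑ i ∈ Finset.range m, f (Fin.ofNat n (t + i)) =
      ∑ i ∈ Finset.range (n - 2), f (Fin.ofNat n (t + i)) := by
    rintro m rfl
    rw [Finset.sum_range_succ, h, add_zero]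
  rw [sum_eq_sum_range_pred hn f t h', key (n - 1) (by omega)]

theorem not_mem_arcSet_iff (hn : 5 ≤ n) (k : Fin n) (t : ℕ) :
    k ∉ arcSet n (Fin.ofNat n t) ↔
      k = Fin.ofNat n (t + (n - 2)) ∨ k = Fin.ofNat n (t + (n - 1)) := by
  obtain ⟨i, hi, rfl⟩ := exists_eq_ofNat_add k t
  rw [ofNat_add_mem_arcSet hi, ofNat_add_inj hi (by omega), ofNat_add_inj hi (by omega)]
  omega

theorem support_subset_arcSet_iff (hn : 5 ≤ n) (v : Fin n → ℝ) (t : ℕ) :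
    Function.support v ⊆ arcSet n (Fin.ofNat n t) ↔
      v (Fin.ofNat n (t + (n - 2))) = 0 ∧ v (Fin.ofNat n (t + (n - 1))) = 0 := by
  constructor
  · intro h
    constructor
    · by_contra h1
      exact (not_mem_arcSet_iff hn _ t).2 (Or.inl rfl) (h h1)
    · by_contra h1
      exact (not_mem_arcSet_iff hn _ t).2 (Or.inr rfl) (h h1)
  · rintro ⟨h1, h2⟩ k hk
    by_contra h
    rcases (not_mem_arcSet_iff hn k t).1 h with rfl | rfl
    exacts [hk h1, hk h2]

/-- If the offset from `k` to `l` is at least `n - 2`, the offset from `l` to `k` is at most `2`,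
which is less than `n - 2` because `n ≥ 5`. -/
theorem exists_arcSet_mem_mem (hn : 5 ≤ n) (k l : Fin n) :
    ∃ j, k ∈ arcSet n j ∧ l ∈ arcSet n j := by
  obtain ⟨i, hi, rfl⟩ := exists_eq_ofNat_add l (k : ℕ)
  rcases lt_or_ge i (n - 2) with h | h
  · refine ⟨Fin.ofNat n k, ?_, (ofNat_add_mem_arcSet hi).2 h⟩
    have := (ofNat_add_mem_arcSet (n := n) (t := k) (i := 0) (by omega)).2 (by omega)
    rw [add_zero, ofNat_val_eq] at this
    rwa [ofNat_val_eq]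
  · refine ⟨Fin.ofNat n (k + i), ?_, ?_⟩
    · have := (ofNat_add_mem_arcSet (n := n) (t := k + i) (i := n - i) (by omega)).2 (by omega)
      rwa [show (k : ℕ) + i + (n - i) = k + n by omega, ofNat_add_period, ofNat_val_eq] at this
    · exact (ofNat_add_mem_arcSet (n := n) (t := k + i) (i := 0) (by omega)).2 (by omega)

end Cyclic

/-! ### The face `F_u`: its exceptional and its positive semi-definite members. -/

section Face

variable {n : ℕ} [NeZero n] {u : Fin n → Fin n → ℝ} {A : Matrix (Fin n) (Fin n) ℝ}

theorem HasCirculantSupports.pos_iff (hu : HasCirculantSupports u) (j k : Fin n) :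
    0 < u j k ↔ k ∈ arcSet n j := by
  rw [← (hu j).2, Function.mem_support]
  exact ⟨fun h => h.ne', fun h => lt_of_le_of_ne ((hu j).1 k) (Ne.symm h)⟩

theorem HasCirculantSupports.eq_zero_iff (hu : HasCirculantSupports u) (j k : Fin n) :
    u j k = 0 ↔ k ∉ arcSet n j := by
  rw [← (hu j).2, Function.notMem_support]

theorem HasCirculantSupports.pos (hu : HasCirculantSupports u) (t : ℕ) {i : ℕ} (hi : i < n - 2) :
    0 < u (Fin.ofNat n t) (Fin.ofNat n (t + i)) :=
  (hu.pos_iff _ _).2 ((ofNat_add_mem_arcSet (by omega)).2 hi)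

theorem HasCirculantSupports.pos_self (hu : HasCirculantSupports u) (hn : 5 ≤ n) (j : Fin n) :
    0 < u j j := by
  have := hu.pos (j : ℕ) (i := 0) (by omega)
  rwa [add_zero, ofNat_val_eq] at this

theorem HasCirculantSupports.eq_zero (hu : HasCirculantSupports u) (t : ℕ) {i : ℕ}
    (hi : n - 2 ≤ i) (hi' : i < n) : u (Fin.ofNat n t) (Fin.ofNat n (t + i)) = 0 := by
  rw [hu.eq_zero_iff, ofNat_add_mem_arcSet hi']
  omega

theorem isZeroOf_of_mem_face (hn : 5 ≤ n) (hu : HasCirculantSupports u)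
    (hA : A ∈ copositiveFace u) (j : Fin n) : IsZeroOf A (u j) :=
  ⟨fun h => (hu.pos_self hn j).ne' (congrFun h j), (hu j).1, hA.2 j⟩

theorem mulVec_eq_zero_of_mem_arcSet (hn : 5 ≤ n) (hu : HasCirculantSupports u)
    (hA : A ∈ copositiveFace u) {j k : Fin n} (hk : k ∈ arcSet n j) : (A *ᵥ u j) k = 0 :=
  (isZeroOf_of_mem_face hn hu hA j).mulVec_eq_zero hA.1 ((hu.pos_iff j k).2 hk).ne'

theorem arcSubmatrix_mulVec (hn : 5 ≤ n) (A : Matrix (Fin n) (Fin n) ℝ) (t : ℕ) {v : Fin n → ℝ}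
    (h : v (Fin.ofNat n (t + (n - 2))) = 0) (h' : v (Fin.ofNat n (t + (n - 1))) = 0)
    (i : Fin (n - 2)) :
    (arcSubmatrix A (Fin.ofNat n t) *ᵥ (v ∘ arc n (Fin.ofNat n t))) i =
      (A *ᵥ v) (Fin.ofNat n (t + i)) := by
  simp only [mulVec, dotProduct]
  rw [sum_eq_sum_range_arc hn _ t (by rw [h, mul_zero]) (by rw [h', mul_zero]),
    ← Fin.sum_univ_eq_sum_range (fun i' => A (Fin.ofNat n (t + i)) (Fin.ofNat n (t + i')) *
      v (Fin.ofNat n (t + i')))]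
  simp only [arcSubmatrix, submatrix_apply, Function.comp, arc_ofNat]

theorem mem_matrixSpace_iff (hn : 5 ≤ n) (hu : HasCirculantSupports u) :
    A ∈ matrixSpace u ↔ A.IsSymm ∧ ∀ j, ∀ k ∈ arcSet n j, (A *ᵥ u j) k = 0 := by
  have h : ∀ (t : ℕ) (i : Fin (n - 2)),
      (arcSubmatrix A (Fin.ofNat n t) *ᵥ (u (Fin.ofNat n t) ∘ arc n (Fin.ofNat n t))) i =
      (A *ᵥ u (Fin.ofNat n t)) (Fin.ofNat n (t + i)) := fun t =>
    arcSubmatrix_mulVec hn A t (hu.eq_zero t le_rfl (by omega)) (hu.eq_zero t (by omega) (by omega))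
  constructor
  · rintro ⟨h1, h2⟩
    refine ⟨h1, fun j => ?_⟩
    rw [← ofNat_val_eq j]
    rintro _ ⟨i, rfl⟩
    rw [arc_ofNat, ← h, h2]
    rfl
  · rintro ⟨h1, h2⟩
    refine ⟨h1, fun j => ?_⟩
    rw [← ofNat_val_eq j]
    ext i
    rw [h]
    exact h2 _ _ ((ofNat_add_mem_arcSet (by omega)).2 i.2)

theorem mem_matrixSpace_of_mem_face (hn : 5 ≤ n) (hu : HasCirculantSupports u)
    (hA : A ∈ copositiveFace u) : A ∈ matrixSpace u :=
  (mem_matrixSpace_iff hn hu).2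
    ⟨hA.1.1, fun _ _ hk => mulVec_eq_zero_of_mem_arcSet hn hu hA hk⟩

/-- The forms in the face `F_u` that are not exceptional are positive semi-definite. -/
theorem posSemidef_of_not_isExceptional (hn : 5 ≤ n) (hu : HasCirculantSupports u)
    (hA : A ∈ copositiveFace u) (h : ¬ IsExceptional A) :
    A.PosSemidef ∧ ∀ j, A *ᵥ u j = 0 := by
  have h1 : ∃ P N : Matrix (Fin n) (Fin n) ℝ,
      P.PosSemidef ∧ N.IsSymm ∧ (∀ i j, 0 ≤ N i j) ∧ A = P + N := by
    by_contra h1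
    exact h ⟨hA.1, h1⟩
  obtain ⟨P, N, hP, -, hN, rfl⟩ := h1
  have hNu : ∀ j, 0 ≤ N *ᵥ u j := fun j k => by
    change 0 ≤ ∑ l, N k l * u j l
    exact Finset.sum_nonneg fun l _ => mul_nonneg (hN k l) ((hu j).1 l)
  -- Both summands vanish at `u j`. As `N` has nonnegative entries, it vanishes on each arc, and any
  -- two indices share an arc.
  have hN0 : N = 0 := by
    ext k l
    obtain ⟨j, hk, hl⟩ := exists_arcSet_mem_mem hn k l
    have h2 := hA.2 j
    rw [add_mulVec, dotProduct_add] at h2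
    have h3 := hP.quadratic_nonneg (u j)
    have h4 : 0 ≤ u j ⬝ᵥ (N *ᵥ u j) :=
      Finset.sum_nonneg fun i _ => mul_nonneg ((hu j).1 i) (hNu j i)
    have h5 : u j ⬝ᵥ (N *ᵥ u j) = 0 := by linarith
    rw [dotProduct, Finset.sum_eq_zero_iff_of_nonneg
      (fun i _ => mul_nonneg ((hu j).1 i) (hNu j i))] at h5
    have h6 := (mul_eq_zero.1 (h5 k (Finset.mem_univ _))).resolve_left
      ((hu.pos_iff j k).2 hk).ne'
    rw [mulVec, dotProduct, Finset.sum_eq_zero_iff_of_nonneg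
      (fun i _ => mul_nonneg (hN k i) ((hu j).1 i))] at h6
    exact (mul_eq_zero.1 (h6 l (Finset.mem_univ _))).resolve_right ((hu.pos_iff j l).2 hl).ne'
  subst hN0
  rw [add_zero] at hA ⊢
  refine ⟨hP, fun j => ?_⟩
  rw [← hP.dotProduct_mulVec_zero_iff]
  simpa using hA.2 j

/-- Suppose `A u^j` vanished at `k`, and let `m` be the other index off the arc. The second order
condition at `u^j`, used for `x` or `-x`, makes `A` nonnegative on `x m = 0`. As `u^m` is a zero
with positive entry at `m`, `exists_posSemidef_add_nonneg` contradicts exceptionality. -/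
theorem IsExceptional.mulVec_pos (hn : 5 ≤ n) (hu : HasCirculantSupports u)
    (hA : A ∈ copositiveFace u) (hexc : IsExceptional A) {j k : Fin n} (hk : k ∉ arcSet n j) :
    0 < (A *ᵥ u j) k := by
  have hz := isZeroOf_of_mem_face hn hu hA j
  refine lt_of_le_of_ne (hz.mulVec_nonneg hA.1 k) fun h0 => ?_
  obtain ⟨m, hm⟩ : ∃ m, ∀ i, i ∉ arcSet n j → i = k ∨ i = m := by
    rw [← ofNat_val_eq j] at hk ⊢
    simp only [not_mem_arcSet_iff hn] at hk ⊢
    rcases hk with rfl | rfl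
    · exact ⟨_, fun i hi => hi⟩
    · exact ⟨_, fun i hi => hi.symm⟩
  have key : ∀ x : Fin n → ℝ, x m = 0 → 0 ≤ x k → 0 ≤ x ⬝ᵥ (A *ᵥ x) := by
    intro x hx hxk
    refine hz.second_order hA.1 (fun i hi => ?_) (hz.dotProduct_eq_zero hA.1 fun i hi => ?_)
    · rcases hm i ((hu.eq_zero_iff j i).1 hi) with rfl | rfl
      exacts [hxk, hx.ge]
    · rcases hm i ((hu.eq_zero_iff j i).1 hi) with rfl | rfl
      exacts [Or.inr h0.symm, Or.inl hx]
  have hzm := isZeroOf_of_mem_face hn hu hA m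
  refine hexc.2 (exists_posSemidef_add_nonneg hA.1.1 hzm.2.1 hzm.2.2 (hzm.mulVec_nonneg hA.1)
    (hu.pos_self hn m) fun x hx => ?_)
  rcases le_total 0 (x k) with h | h
  · exact key x hx h
  · simpa [mulVec_neg] using key (-x) (by simp [hx]) (by simpa using h)

end Face

/-! The evaluation functionals and the bilinear form of a matrix. -/

section Functionals

variable {n : ℕ} [NeZero n] {u : Fin n → Fin n → ℝ}

theorem sum_smul_evalAt_eq_zero (u : Fin n → Fin n → ℝ) (t : ℕ) :
    ∑ i ∈ Finset.range (n - 2), u (Fin.ofNat n t) (Fin.ofNat n (t + i)) • evalAt u (t + i) = 0 := by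
  ext x
  have h := x.2 t
  simp only [arc_ofNat] at h
  rw [Fin.sum_univ_eq_sum_range (fun i => u (Fin.ofNat n t) (Fin.ofNat n (t + i)) *
    (x : ℕ → ℝ) (t + i))] at h
  rw [LinearMap.sum_apply]
  exact h

theorem sum_smul_evalAt_split (hn : 5 ≤ n) (u : Fin n → Fin n → ℝ) (t : ℕ) (f : ℕ → ℝ) :
    ∑ i ∈ Finset.range (n - 2), f i • evalAt u (t + i) =
      ∑ i ∈ Finset.range (n - 3), f i • evalAt u (t + i) + f (n - 3) • evalAt u (t + (n - 3)) := by
  rw [show n - 2 = n - 3 + 1 by omega, Finset.sum_range_succ]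

theorem sum_smul_evalAt_split_first (hn : 5 ≤ n) (u : Fin n → Fin n → ℝ) (t : ℕ) (f : ℕ → ℝ) :
    ∑ i ∈ Finset.range (n - 2), f i • evalAt u (t + i) =
      ∑ i ∈ Finset.range (n - 3), f (i + 1) • evalAt u (t + 1 + i) + f 0 • evalAt u t := by
  rw [show n - 2 = n - 3 + 1 by omega, Finset.sum_range_succ', add_zero]
  simp only [add_comm, add_left_comm]

/-- The relation with coefficients `u^t` expresses `e_t` through the next `n - 3` functionals, as
its first coefficient is nonzero. -/
theorem span_window_eq_top (hn : 5 ≤ n) (hu : HasCirculantSupports u) (t : ℕ) :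
    ⊤ ≤ Submodule.span ℝ (Set.range fun i : Fin (n - 3) => evalAt u (t + i)) := by
  induction t with
  | zero =>
    rw [← (evalBasis hn hu).span_eq]
    apply Submodule.span_mono
    rintro _ ⟨i, rfl⟩
    exact ⟨i, by simp only [evalBasis_apply, zero_add]⟩
  | succ t ih =>
    refine ih.trans (Submodule.span_le.2 ?_)
    have hmem : ∀ i < n - 3, evalAt u (t + 1 + i) ∈
        Submodule.span ℝ (Set.range fun i : Fin (n - 3) => evalAt u (t + 1 + i)) :=
      fun i hi => Submodule.subset_span ⟨⟨i, hi⟩, rfl⟩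
    rintro _ ⟨⟨i, hi⟩, rfl⟩
    rcases i with _ | i
    · have h := sum_smul_evalAt_eq_zero u t
      rw [sum_smul_evalAt_split_first hn u t
        (fun i => u (Fin.ofNat n t) (Fin.ofNat n (t + i)))] at h
      have h0 : u (Fin.ofNat n t) (Fin.ofNat n (t + 0)) ≠ 0 := (hu.pos t (by omega)).ne'
      rw [SetLike.mem_coe, ← Submodule.smul_mem_iff _ h0]
      change _ • evalAt u t ∈ _
      rw [eq_neg_of_add_eq_zero_right h]
      exact Submodule.neg_mem _ (Submodule.sum_mem _ fun i hi =>
        Submodule.smul_mem _ _ (hmem i (by simpa using hi)))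
    · have := hmem i (by omega)
      rwa [show t + 1 + i = t + (i + 1) by omega] at this

theorem finrank_dual (hn : 5 ≤ n) (hu : HasCirculantSupports u) :
    Module.finrank ℝ (Module.Dual ℝ (solutionSpace u)) = n - 3 := by
  rw [Module.finrank_eq_card_basis (evalBasis hn hu), Fintype.card_fin]

/-- The basis `e_t, …, e_{t + d - 1}` of the dual of the solution space. -/
noncomputable def windowBasis (hn : 5 ≤ n) (hu : HasCirculantSupports u) (t : ℕ) :
    Module.Basis (Fin (n - 3)) ℝ (Module.Dual ℝ (solutionSpace u)) :=
  basisOfTopLeSpanOfCardEqFinrank (fun i : Fin (n - 3) => evalAt u (t + i))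
    (span_window_eq_top hn hu t) (by rw [finrank_dual hn hu, Fintype.card_fin])

@[simp]
theorem windowBasis_apply (hn : 5 ≤ n) (hu : HasCirculantSupports u) (t : ℕ) (i : Fin (n - 3)) :
    windowBasis hn hu t i = evalAt u (t + i) := by
  simp [windowBasis]

theorem finiteDimensional_dual (hn : 5 ≤ n) (hu : HasCirculantSupports u) :
    FiniteDimensional ℝ (Module.Dual ℝ (solutionSpace u)) :=
  Module.Basis.finiteDimensional_of_finite (evalBasis hn hu)

theorem window_coeff_eq_zero (hn : 5 ≤ n) (hu : HasCirculantSupports u) (t : ℕ) {f : ℕ → ℝ}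
    (h : ∑ i ∈ Finset.range (n - 3), f i • evalAt u (t + i) = 0) {i : ℕ} (hi : i < n - 3) :
    f i = 0 := by
  rw [← Fin.sum_univ_eq_sum_range (fun i => f i • evalAt u (t + i))] at h
  have h1 := (windowBasis hn hu t).linearIndependent
  rw [Fintype.linearIndependent_iff] at h1
  exact h1 (fun i => f i) (by simpa using h) ⟨i, hi⟩

/-- The linear map taking `x` to `∑ x_k e_k`, where `k` runs over the arc starting at `t`. -/
noncomputable def arcSum (u : Fin n → Fin n → ℝ) (t : ℕ) :
    (Fin n → ℝ) →ₗ[ℝ] Module.Dual ℝ (solutionSpace u) :=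
  ∑ i ∈ Finset.range (n - 2), (LinearMap.proj (Fin.ofNat n (t + i))).smulRight (evalAt u (t + i))

theorem arcSum_apply (u : Fin n → Fin n → ℝ) (t : ℕ) (x : Fin n → ℝ) :
    arcSum u t x = ∑ i ∈ Finset.range (n - 2), x (Fin.ofNat n (t + i)) • evalAt u (t + i) := by
  simp [arcSum, LinearMap.sum_apply]

theorem arcSum_self (u : Fin n → Fin n → ℝ) (t : ℕ) : arcSum u t (u (Fin.ofNat n t)) = 0 := by
  rw [arcSum_apply, sum_smul_evalAt_eq_zero]

/-- The representative vanishes also at the last place `n - 3` of the arc, which removes the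
ambiguity by multiples of `u^t`. -/
theorem exists_arcSum_eq (hn : 5 ≤ n) (hu : HasCirculantSupports u) (t : ℕ)
    (w : Module.Dual ℝ (solutionSpace u)) :
    ∃ x : Fin n → ℝ, (∀ i, n - 3 ≤ i → i < n → x (Fin.ofNat n (t + i)) = 0) ∧
      arcSum u t x = w := by
  have hw := span_window_eq_top hn hu t (Submodule.mem_top (x := w))
  induction hw using Submodule.span_induction with
  | mem w hw =>
    obtain ⟨⟨i, hi⟩, rfl⟩ := hw
    refine ⟨Pi.single (Fin.ofNat n (t + i)) 1, fun j hj hj' => ?_, ?_⟩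
    · rw [Pi.single_eq_of_ne]
      rw [Ne, ofNat_add_inj hj' (by omega)]
      omega
    · rw [arcSum_apply, Finset.sum_eq_single i]
      · simp
      · intro j hj hij
        rw [Finset.mem_range] at hj
        rw [Pi.single_eq_of_ne, zero_smul]
        rwa [Ne, ofNat_add_inj (by omega) (by omega)]
      · intro h
        rw [Finset.mem_range] at h
        omega
  | zero => exact ⟨0, by simp, by simp⟩
  | add w w' _ _ h h' =>
    obtain ⟨x, hx, rfl⟩ := h
    obtain ⟨x', hx', rfl⟩ := h'
    exact ⟨x + x', fun i h h' => by rw [Pi.add_apply, hx i h h', hx' i h h', add_zero], map_add _ _ _⟩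
  | smul c w _ h =>
    obtain ⟨x, hx, rfl⟩ := h
    exact ⟨c • x, fun i h h' => by rw [Pi.smul_apply, hx i h h', smul_zero], map_smul _ _ _⟩

theorem dualMap_monodromy_evalAt (u : Fin n → Fin n → ℝ) (t : ℕ) :
    (monodromy u).dualMap (evalAt u t) = evalAt u (t + n) := rfl

end Functionals

/-! ### Comparison of a matrix with its bilinear form. -/

section Form

variable {n : ℕ} [NeZero n] {u : Fin n → Fin n → ℝ} (hn : 5 ≤ n) (hu : HasCirculantSupports u)
  (A : matrixSpace u)

theorem formOfMatrix_symm (x y : Module.Dual ℝ (solutionSpace u)) :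
    formOfMatrix hn hu A x y = formOfMatrix hn hu A y x := by
  have h : formOfMatrix hn hu A = (formOfMatrix hn hu A).flip := by
    refine LinearMap.BilinForm.ext_basis (evalBasis hn hu) fun i j => ?_
    rw [LinearMap.BilinForm.flip_apply, evalBasis_apply, evalBasis_apply, formOfMatrix_evalAt,
      formOfMatrix_evalAt]
    exact (A.2.1.apply _ _).symm
  conv_lhs => rw [h]
  rfl

theorem matrixSpace_sum_eq_zero (hn : 5 ≤ n) (hu : HasCirculantSupports u) (A : matrixSpace u)
    (t : ℕ) {i : ℕ} (hi : i < n - 2) :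
    ∑ j ∈ Finset.range (n - 2), u (Fin.ofNat n t) (Fin.ofNat n (t + j)) *
      (A : Matrix (Fin n) (Fin n) ℝ) (Fin.ofNat n (t + j)) (Fin.ofNat n (t + i)) = 0 := by
  have h := ((mem_matrixSpace_iff hn hu).1 A.2).2 (Fin.ofNat n t) _
    ((ofNat_add_mem_arcSet (by omega)).2 hi)
  rw [mulVec, dotProduct, sum_eq_sum_range_arc hn _ t
    (by rw [hu.eq_zero t le_rfl (by omega), mul_zero])
    (by rw [hu.eq_zero t (by omega) (by omega), mul_zero])] at h
  rw [← h]
  refine Finset.sum_congr rfl fun j _ => ?_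
  rw [mul_comm, A.2.1.apply]

theorem form_sum_eq_zero (t : ℕ) (w : Module.Dual ℝ (solutionSpace u)) :
    ∑ j ∈ Finset.range (n - 2), u (Fin.ofNat n t) (Fin.ofNat n (t + j)) *
      formOfMatrix hn hu A (evalAt u (t + j)) w = 0 := by
  have h := congrArg (fun z => formOfMatrix hn hu A z w) (sum_smul_evalAt_eq_zero u t)
  simpa using h

/-- The form agrees with the matrix on every window of length `n - 2`. -/
theorem form_evalAt (t : ℕ) : ∀ i < n - 2, ∀ j < n - 2,
    formOfMatrix hn hu A (evalAt u (t + i)) (evalAt u (t + j)) =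
      (A : Matrix (Fin n) (Fin n) ℝ) (Fin.ofNat n (t + i)) (Fin.ofNat n (t + j)) := by
  have hsymm : ∀ a b : Fin n, (A : Matrix (Fin n) (Fin n) ℝ) a b = (A : Matrix _ _ ℝ) b a :=
    fun a b => A.2.1.apply b a
  -- The last row of the longer window is determined by the others, for the matrix and for the form
  -- alike, through the relation `u^t` with nonzero last coefficient.
  have extend : ∀ t,
      (∀ i < n - 3, ∀ j < n - 3, formOfMatrix hn hu A (evalAt u (t + i)) (evalAt u (t + j)) =
        (A : Matrix (Fin n) (Fin n) ℝ) (Fin.ofNat n (t + i)) (Fin.ofNat n (t + j))) →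
      ∀ i < n - 2, ∀ j < n - 2, formOfMatrix hn hu A (evalAt u (t + i)) (evalAt u (t + j)) =
        (A : Matrix (Fin n) (Fin n) ℝ) (Fin.ofNat n (t + i)) (Fin.ofNat n (t + j)) := by
    intro t h
    have step : ∀ j < n - 2,
        (∀ i < n - 3, formOfMatrix hn hu A (evalAt u (t + i)) (evalAt u (t + j)) =
          (A : Matrix (Fin n) (Fin n) ℝ) (Fin.ofNat n (t + i)) (Fin.ofNat n (t + j))) →
        formOfMatrix hn hu A (evalAt u (t + (n - 3))) (evalAt u (t + j)) =
          (A : Matrix (Fin n) (Fin n) ℝ) (Fin.ofNat n (t + (n - 3))) (Fin.ofNat n (t + j)) := by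
      intro j hj hi
      have h1 := matrixSpace_sum_eq_zero hn hu A t hj
      have h2 := form_sum_eq_zero hn hu A t (evalAt u (t + j))
      rw [show n - 2 = n - 3 + 1 by omega, Finset.sum_range_succ] at h1 h2
      rw [Finset.sum_congr rfl fun i hi' => by
        rw [hi i (Finset.mem_range.1 hi')], ← h1] at h2
      exact mul_left_cancel₀ (hu.pos t (by omega)).ne' (add_left_cancel h2)
    have h1 : ∀ i < n - 2, ∀ j < n - 3,
        formOfMatrix hn hu A (evalAt u (t + i)) (evalAt u (t + j)) =
        (A : Matrix (Fin n) (Fin n) ℝ) (Fin.ofNat n (t + i)) (Fin.ofNat n (t + j)) := by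
      intro i hi j hj
      rcases lt_or_ge i (n - 3) with hi' | hi'
      · exact h i hi' j hj
      · obtain rfl : i = n - 3 := by omega
        exact step j (by omega) fun i hi => h i hi j hj
    intro i hi j hj
    rcases lt_or_ge i (n - 3) with hi' | hi'
    · rw [formOfMatrix_symm, hsymm]
      exact h1 j hj i hi'
    · obtain rfl : i = n - 3 := by omega
      refine step j hj fun i hi => ?_
      rw [formOfMatrix_symm, hsymm]
      exact h1 j hj i hi
  induction t with
  | zero =>
    refine extend 0 fun i hi j hj => ?_
    rw [zero_add, zero_add]
    exact formOfMatrix_evalAt hn hu A ⟨i, hi⟩ ⟨j, hj⟩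
  | succ t ih =>
    refine extend (t + 1) fun i hi j hj => ?_
    -- The last `n - 3` places of the window at `t` are the first `n - 3` places of the window at `t
    -- + 1`.
    have := ih (i + 1) (by omega) (j + 1) (by omega)
    rwa [show t + (i + 1) = t + 1 + i by omega, show t + (j + 1) = t + 1 + j by omega] at this

/-- The dual of the monodromy moves the window at `0` to the window at `n`, on which the form has
the same entries of `A`. -/
theorem form_dualMap (x y : Module.Dual ℝ (solutionSpace u)) :
    formOfMatrix hn hu A ((monodromy u).dualMap x) ((monodromy u).dualMap y) =
      formOfMatrix hn hu A x y := by
  have h : (formOfMatrix hn hu A).comp (monodromy u).dualMap (monodromy u).dualMap =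
      formOfMatrix hn hu A := by
    refine LinearMap.BilinForm.ext_basis (evalBasis hn hu) fun i j => ?_
    rw [LinearMap.BilinForm.comp_apply, evalBasis_apply, evalBasis_apply, formOfMatrix_evalAt,
      dualMap_monodromy_evalAt, dualMap_monodromy_evalAt, add_comm (i : ℕ), add_comm (j : ℕ),
      form_evalAt hn hu A n i (by omega) j (by omega), add_comm n, add_comm n, ofNat_add_period,
      ofNat_add_period]
  exact congrArg (fun B : LinearMap.BilinForm ℝ _ => B x y) h

theorem form_evalAt_arcSum (t : ℕ) {x : Fin n → ℝ} (h : x (Fin.ofNat n (t + (n - 2))) = 0)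
    (h' : x (Fin.ofNat n (t + (n - 1))) = 0) {i : ℕ} (hi : i < n - 2) :
    formOfMatrix hn hu A (evalAt u (t + i)) (arcSum u t x) =
      ((A : Matrix (Fin n) (Fin n) ℝ) *ᵥ x) (Fin.ofNat n (t + i)) := by
  rw [mulVec, dotProduct, sum_eq_sum_range_arc hn _ t (by rw [h, mul_zero]) (by rw [h', mul_zero]),
    arcSum_apply, map_sum]
  refine Finset.sum_congr rfl fun j hj => ?_
  rw [map_smul, form_evalAt hn hu A t i hi j (Finset.mem_range.1 hj), smul_eq_mul, mul_comm]

theorem form_arcSum_arcSum (t : ℕ) {x : Fin n → ℝ} (h : x (Fin.ofNat n (t + (n - 2))) = 0)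
    (h' : x (Fin.ofNat n (t + (n - 1))) = 0) :
    formOfMatrix hn hu A (arcSum u t x) (arcSum u t x) =
      x ⬝ᵥ ((A : Matrix (Fin n) (Fin n) ℝ) *ᵥ x) := by
  rw [dotProduct, sum_eq_sum_range_arc hn _ t (by rw [h, zero_mul]) (by rw [h', zero_mul])]
  conv_lhs =>
    enter [2]
    rw [arcSum_apply u t x]
  rw [map_sum]
  refine Finset.sum_congr rfl fun j hj => ?_
  rw [map_smul, formOfMatrix_symm, form_evalAt_arcSum hn hu A t h h' (Finset.mem_range.1 hj),
    smul_eq_mul]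

/-- Each functional is represented by a vector supported in the arc at `0`, where the second order
condition at the zero `u^0` applies in all directions. -/
theorem form_nonneg (hA : (A : Matrix (Fin n) (Fin n) ℝ) ∈ copositiveFace u)
    (w : Module.Dual ℝ (solutionSpace u)) : 0 ≤ formOfMatrix hn hu A w w := by
  obtain ⟨x, hx, rfl⟩ := exists_arcSum_eq hn hu 0 w
  have hx2 := hx (n - 2) (by omega) (by omega)
  have hx1 := hx (n - 1) (by omega) (by omega)
  rw [form_arcSum_arcSum hn hu A 0 hx2 hx1]
  have hz := isZeroOf_of_mem_face hn hu hA (Fin.ofNat n 0)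
  have h0 : ∀ i, u (Fin.ofNat n 0) i = 0 → x i = 0 := by
    intro i hi
    rw [hu.eq_zero_iff, not_mem_arcSet_iff hn] at hi
    rcases hi with rfl | rfl
    exacts [hx2, hx1]
  exact hz.second_order hA.1 (fun i hi => (h0 i hi).ge)
    (hz.dotProduct_eq_zero hA.1 fun i hi => Or.inl (h0 i hi))

/-- The defect of periodicity of the form at the pair `e_t, e_{t - 2}`. -/
noncomputable def formDefect (t : ℕ) : ℝ :=
  (A : Matrix (Fin n) (Fin n) ℝ) (Fin.ofNat n t) (Fin.ofNat n (t + (n - 2))) -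
    formOfMatrix hn hu A (evalAt u t) (evalAt u (t + (n - 2)))

/-- Subtract from the entry of `A u^t` the vanishing sum with `B` in place of `A`: for `i > 0` the
places `t + i` and `t + (n - 2)` share a window of length `n - 2`, so only the term `i = 0`
survives. -/
theorem mulVec_eq_formDefect (t : ℕ) :
    ((A : Matrix (Fin n) (Fin n) ℝ) *ᵥ u (Fin.ofNat n t)) (Fin.ofNat n (t + (n - 2))) =
      u (Fin.ofNat n t) (Fin.ofNat n t) * formDefect hn hu A t := by
  have h := form_sum_eq_zero hn hu A t (evalAt u (t + (n - 2)))
  rw [mulVec, dotProduct, sum_eq_sum_range_arc hn _ t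
    (by rw [hu.eq_zero t le_rfl (by omega), mul_zero])
    (by rw [hu.eq_zero t (by omega) (by omega), mul_zero]), ← sub_zero (Finset.sum _ _), ← h,
    ← Finset.sum_sub_distrib, Finset.sum_eq_single 0]
  · rw [formDefect, A.2.1.apply]
    simp only [add_zero]
    ring
  · intro i hi hi0
    rw [Finset.mem_range] at hi
    have h1 := form_evalAt hn hu A (t + i) 0 (by omega) (n - 2 - i) (by omega)
    rw [add_zero, show t + i + (n - 2 - i) = t + (n - 2) by omega] at h1
    rw [h1, A.2.1.apply]
    ring
  · intro h
    rw [Finset.mem_range] at h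
    omega

theorem sum_range_corner {m : ℕ} (hm : m ≠ 0) {g : ℕ → ℕ → ℝ}
    (hg : ∀ i < m + 1, ∀ j < m + 1, ¬ (i = 0 ∧ j = m) → ¬ (i = m ∧ j = 0) → g i j = 0) :
    ∑ i ∈ Finset.range (m + 1), ∑ j ∈ Finset.range (m + 1), g i j = g 0 m + g m 0 := by
  rw [Finset.sum_eq_add 0 m (Ne.symm hm)]
  · congr 1
    · refine Finset.sum_eq_single m (fun j hj hjm => ?_) (by simp)
      exact hg 0 (by omega) j (Finset.mem_range.1 hj) (by tauto) (by omega)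
    · refine Finset.sum_eq_single 0 (fun j hj hjm => ?_) (by simp)
      exact hg m (by omega) j (Finset.mem_range.1 hj) (by omega) (by tauto)
  · intro i hi hne
    exact Finset.sum_eq_zero fun j hj =>
      hg i (Finset.mem_range.1 hi) j (Finset.mem_range.1 hj) (by tauto) (by tauto)
  · simp
  · simp

/-- The quadratic form of the matrix on a coordinate hyperplane. -/
theorem quadratic_eq_form_add (t : ℕ) {x : Fin n → ℝ} (h : x (Fin.ofNat n (t + (n - 1))) = 0) :
    ∃ w, x ⬝ᵥ ((A : Matrix (Fin n) (Fin n) ℝ) *ᵥ x) = formOfMatrix hn hu A w w +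
      2 * (x (Fin.ofNat n t) * x (Fin.ofNat n (t + (n - 2))) * formDefect hn hu A t) := by
  refine ⟨∑ i ∈ Finset.range (n - 1), x (Fin.ofNat n (t + i)) • evalAt u (t + i), ?_⟩
  have h1 : x ⬝ᵥ ((A : Matrix (Fin n) (Fin n) ℝ) *ᵥ x) =
      ∑ i ∈ Finset.range (n - 1), ∑ j ∈ Finset.range (n - 1),
        x (Fin.ofNat n (t + i)) * x (Fin.ofNat n (t + j)) *
          (A : Matrix (Fin n) (Fin n) ℝ) (Fin.ofNat n (t + i)) (Fin.ofNat n (t + j)) := by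
    rw [dotProduct, sum_eq_sum_range_pred hn _ t (by rw [h, zero_mul])]
    refine Finset.sum_congr rfl fun i _ => ?_
    rw [mulVec, dotProduct, sum_eq_sum_range_pred hn _ t (by rw [h, mul_zero]), Finset.mul_sum]
    exact Finset.sum_congr rfl fun j _ => by ring
  have h2 : formOfMatrix hn hu A
      (∑ i ∈ Finset.range (n - 1), x (Fin.ofNat n (t + i)) • evalAt u (t + i))
      (∑ i ∈ Finset.range (n - 1), x (Fin.ofNat n (t + i)) • evalAt u (t + i)) =
      ∑ i ∈ Finset.range (n - 1), ∑ j ∈ Finset.range (n - 1),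
        x (Fin.ofNat n (t + i)) * x (Fin.ofNat n (t + j)) *
          formOfMatrix hn hu A (evalAt u (t + i)) (evalAt u (t + j)) := by
    rw [LinearMap.map_sum₂]
    refine Finset.sum_congr rfl fun i _ => ?_
    rw [map_sum]
    refine Finset.sum_congr rfl fun j _ => ?_
    rw [map_smul, map_smul, LinearMap.smul_apply, smul_eq_mul, smul_eq_mul]
    ring
  rw [← sub_eq_iff_eq_add', h1, h2, ← Finset.sum_sub_distrib]
  simp only [← Finset.sum_sub_distrib]
  rw [show n - 1 = n - 2 + 1 by omega, sum_range_corner (by omega), add_zero,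
    formOfMatrix_symm hn hu A (evalAt u (t + (n - 2))), ← A.2.1.apply (Fin.ofNat n t), formDefect,
    ← A.2.1.apply (Fin.ofNat n t)]
  · ring
  · intro i hi j hj h3 h4
    rw [sub_eq_zero]
    congr 1
    -- Among `n - 1` consecutive places only the first and last do not share a window; all other
    -- pairs lie in the window at `t` or at `t + 1`.
    rcases Nat.eq_zero_or_pos (min i j) with h0 | h0
    · exact (form_evalAt hn hu A t i (by omega) j (by omega)).symm
    · have := form_evalAt hn hu A (t + 1) (i - 1) (by omega) (j - 1) (by omega)
      rwa [show t + 1 + (i - 1) = t + i by omega, show t + 1 + (j - 1) = t + j by omega,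
        eq_comm] at this

end Form

/-! Copositivity in terms of the form, and the zeros of exceptional forms. -/

section Copositivity

variable {n : ℕ} [NeZero n] {u : Fin n → Fin n → ℝ}

/-- On a boundary face of the orthant, `quadratic_eq_form_add` is a sum of nonnegative terms. From
an arbitrary point one subtracts `u 0` until the boundary is reached, and adding it back cannot
decrease the value because `A u^0 ≥ 0`. -/
theorem isCopositive_of_form_nonneg (hn : 5 ≤ n) (hu : HasCirculantSupports u) (A : matrixSpace u)
    (hB : ∀ w, 0 ≤ formOfMatrix hn hu A w w)
    (hAu : ∀ j, 0 ≤ (A : Matrix (Fin n) (Fin n) ℝ) *ᵥ u j) :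
    IsCopositive (A : Matrix (Fin n) (Fin n) ℝ) := by
  have key : ∀ x : Fin n → ℝ, 0 ≤ x → (∃ k, x k = 0) →
      0 ≤ x ⬝ᵥ ((A : Matrix (Fin n) (Fin n) ℝ) *ᵥ x) := by
    rintro x hx ⟨k, hk⟩
    obtain ⟨w, hw⟩ := quadratic_eq_form_add hn hu A ((k : ℕ) + 1) (x := x) (by
      rwa [show (k : ℕ) + 1 + (n - 1) = k + n by omega, ofNat_add_period, ofNat_val_eq])
    rw [hw]
    have h1 : 0 ≤ formDefect hn hu A ((k : ℕ) + 1) := by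
      have h2 := hAu (Fin.ofNat n (k + 1)) (Fin.ofNat n (k + 1 + (n - 2)))
      rw [mulVec_eq_formDefect hn hu A] at h2
      exact nonneg_of_mul_nonneg_right h2 (hu.pos_self hn _)
    have h2 := mul_nonneg (mul_nonneg (hx (Fin.ofNat n (k + 1)))
      (hx (Fin.ofNat n (k + 1 + (n - 2))))) h1
    have h3 := hB w
    linarith
  refine ⟨A.2.1, fun x hx => ?_⟩
  obtain ⟨t, ht, hz, i, -, hi⟩ := exists_add_smul_boundary (v := x) (y := -u 0) hx
    ⟨0, by simpa using hu.pos_self hn 0⟩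
  set z := x + t • -u 0 with hz'
  have hx' : x = z + t • u 0 := by simp [hz']
  have h1 : 0 ≤ u 0 ⬝ᵥ ((A : Matrix (Fin n) (Fin n) ℝ) *ᵥ z) := by
    rw [dotProduct_mulVec_symm A.2.1]
    exact dotProduct_nonneg_of_nonneg hz (hAu 0)
  have h2 : 0 ≤ u 0 ⬝ᵥ ((A : Matrix (Fin n) (Fin n) ℝ) *ᵥ u 0) :=
    dotProduct_nonneg_of_nonneg (hu 0).1 (hAu 0)
  have h3 := key z hz ⟨i, by simpa [hz'] using hi⟩
  rw [hx', quadratic_add_smul A.2.1]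
  positivity

end Copositivity

/-! ### Zeros of exceptional forms and kernels on arcs. -/

section Zeros

variable {n : ℕ} [NeZero n] {u : Fin n → Fin n → ℝ} {A : Matrix (Fin n) (Fin n) ℝ}

theorem IsExceptional.formDefect_pos (hn : 5 ≤ n) (hu : HasCirculantSupports u)
    (hA : A ∈ copositiveFace u) (hexc : IsExceptional A) (t : ℕ) :
    0 < formDefect hn hu ⟨A, mem_matrixSpace_of_mem_face hn hu hA⟩ t := by
  have h := hexc.mulVec_pos hn hu hA (j := Fin.ofNat n t) (k := Fin.ofNat n (t + (n - 2)))
    (by rw [ofNat_add_mem_arcSet (by omega)]; omega)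
  have h1 := mulVec_eq_formDefect hn hu ⟨A, mem_matrixSpace_of_mem_face hn hu hA⟩ t
  rw [h1] at h
  exact pos_of_mul_pos_right h (hu.pos_self hn _).le

/-- Both terms of `quadratic_eq_form_add` are nonnegative at `v`, so both vanish, and the defect is
positive. Thus a vanishing entry has a vanishing neighbour. -/
theorem IsExceptional.zero_neighbor (hn : 5 ≤ n) (hu : HasCirculantSupports u)
    (hA : A ∈ copositiveFace u) (hexc : IsExceptional A) {v : Fin n → ℝ} (hv : IsZeroOf A v)
    {t : ℕ} (h : v (Fin.ofNat n (t + (n - 1))) = 0) :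
    v (Fin.ofNat n t) = 0 ∨ v (Fin.ofNat n (t + (n - 2))) = 0 := by
  obtain ⟨w, hw⟩ := quadratic_eq_form_add hn hu ⟨A, mem_matrixSpace_of_mem_face hn hu hA⟩ t h
  have h1 := form_nonneg hn hu ⟨A, mem_matrixSpace_of_mem_face hn hu hA⟩ hA w
  have h2 := hexc.formDefect_pos hn hu hA t
  have h3 := mul_nonneg (hv.2.1 (Fin.ofNat n t)) (hv.2.1 (Fin.ofNat n (t + (n - 2))))
  have h4 := mul_nonneg h3 h2.le
  have h5 := hv.2.2
  change v ⬝ᵥ (A *ᵥ v) = _ at hw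
  rw [← mul_eq_zero]
  refine (mul_eq_zero.1 ?_).resolve_right h2.ne'
  linarith

theorem IsExceptional.exists_support_arc (hn : 5 ≤ n) (hu : HasCirculantSupports u)
    (hA : A ∈ copositiveFace u) (hexc : IsExceptional A) {v : Fin n → ℝ} (hv : IsZeroOf A v) :
    ∃ t : ℕ, v (Fin.ofNat n (t + (n - 2))) = 0 ∧ v (Fin.ofNat n (t + (n - 1))) = 0 := by
  -- At a zero with full support all directions are feasible, and `A` would be positive
  -- semi-definite.
  obtain ⟨k, hk⟩ : ∃ k, v k = 0 := by
    by_contra h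
    push Not at h
    obtain ⟨x, hx⟩ := hexc.exists_quadratic_neg
    exact hx.not_ge (hv.second_order hA.1 (fun i hi => absurd hi (h i))
      (hv.dotProduct_eq_zero hA.1 fun i hi => absurd hi (h i)))
  have hk' : v (Fin.ofNat n ((k : ℕ) + 1 + (n - 1))) = 0 := by
    rwa [show (k : ℕ) + 1 + (n - 1) = k + n by omega, ofNat_add_period, ofNat_val_eq]
  rcases hexc.zero_neighbor hn hu hA hv hk' with h | h
  · refine ⟨(k : ℕ) + 2, ?_, ?_⟩
    · rwa [show (k : ℕ) + 2 + (n - 2) = k + n by omega, ofNat_add_period, ofNat_val_eq]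
    · rwa [show (k : ℕ) + 2 + (n - 1) = k + 1 + n by omega, ofNat_add_period]
  · exact ⟨_, h, hk'⟩

/-- Pair `A v = 0` with a `u^j` whose arc misses an index `k` of the support of `v`; there `A u^j`
is positive. -/
theorem IsExceptional.mulVec_ne_zero (hn : 5 ≤ n) (hu : HasCirculantSupports u)
    (hA : A ∈ copositiveFace u) (hexc : IsExceptional A) {v : Fin n → ℝ} (hv : IsZeroOf A v) :
    A *ᵥ v ≠ 0 := by
  intro h0
  obtain ⟨k, hk⟩ : ∃ k, v k ≠ 0 := Function.ne_iff.1 hv.1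
  have hk' : k ∉ arcSet n (Fin.ofNat n ((k : ℕ) + 1)) := by
    rw [not_mem_arcSet_iff hn, show (k : ℕ) + 1 + (n - 1) = k + n by omega, ofNat_add_period,
      ofNat_val_eq]
    exact Or.inr rfl
  have h1 : v ⬝ᵥ (A *ᵥ u (Fin.ofNat n ((k : ℕ) + 1))) = 0 := by
    rw [dotProduct_mulVec_symm hA.1.1, h0, dotProduct_zero]
  rw [dotProduct, Finset.sum_eq_zero_iff_of_nonneg (fun i _ => mul_nonneg (hv.2.1 i)
    ((isZeroOf_of_mem_face hn hu hA _).mulVec_nonneg hA.1 i))] at h1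
  rcases mul_eq_zero.1 (h1 k (Finset.mem_univ _)) with h | h
  · exact hk h
  · exact (hexc.mulVec_pos hn hu hA hk').ne' h

theorem mulVec_eq_zero_of_support_arc (hn : 5 ≤ n) (hu : HasCirculantSupports u)
    (hA : A ∈ copositiveFace u) {v : Fin n → ℝ} (hv : IsZeroOf A v) {t : ℕ}
    (h2 : v (Fin.ofNat n (t + (n - 2))) = 0) (h1 : v (Fin.ofNat n (t + (n - 1))) = 0)
    {i : ℕ} (hi : i < n - 2) : (A *ᵥ v) (Fin.ofNat n (t + i)) = 0 := by
  refine (isZeroOf_of_mem_face hn hu hA (Fin.ofNat n t)).mulVec_eq_zero_of_support hA.1 hv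
    (fun k hk => ?_) (hu.pos t hi).ne'
  rw [hu.eq_zero_iff, not_mem_arcSet_iff hn] at hk
  rcases hk with rfl | rfl
  exacts [h2, h1]

/-- Otherwise the support of `v` lies also in the arc starting at `t + i + 2`. The two arcs cover
all indices, and `A v` vanishes on both. -/
theorem IsExceptional.no_adjacent_zeros (hn : 5 ≤ n) (hu : HasCirculantSupports u)
    (hA : A ∈ copositiveFace u) (hexc : IsExceptional A) {v : Fin n → ℝ} (hv : IsZeroOf A v)
    {t : ℕ} (h2 : v (Fin.ofNat n (t + (n - 2))) = 0) (h1 : v (Fin.ofNat n (t + (n - 1))) = 0)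
    {i : ℕ} (hi : i + 1 < n - 2) (hvi : v (Fin.ofNat n (t + i)) = 0) :
    v (Fin.ofNat n (t + (i + 1))) ≠ 0 := by
  intro hvi'
  refine hexc.mulVec_ne_zero hn hu hA hv (funext fun k => ?_)
  obtain ⟨l, hl, rfl⟩ := exists_eq_ofNat_add k t
  rcases lt_or_ge l (n - 2) with hl' | hl'
  · exact mulVec_eq_zero_of_support_arc hn hu hA hv h2 h1 hl'
  · have := mulVec_eq_zero_of_support_arc hn hu hA hv (t := t + i + 2) (i := l - (i + 2))
      (by rwa [show t + i + 2 + (n - 2) = t + i + n by omega, ofNat_add_period])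
      (by rwa [show t + i + 2 + (n - 1) = t + (i + 1) + n by omega, ofNat_add_period]) (by omega)
    rwa [show t + i + 2 + (l - (i + 2)) = t + l by omega] at this

/-- By `zero_neighbor` a neighbour would vanish too, and both neighbours of an interior place are
still in the arc. -/
theorem IsExceptional.interior_ne_zero (hn : 5 ≤ n) (hu : HasCirculantSupports u)
    (hA : A ∈ copositiveFace u) (hexc : IsExceptional A) {v : Fin n → ℝ} (hv : IsZeroOf A v)
    {t : ℕ} (h2 : v (Fin.ofNat n (t + (n - 2))) = 0) (h1 : v (Fin.ofNat n (t + (n - 1))) = 0)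
    {i : ℕ} (hi0 : 0 < i) (hi : i < n - 3) : v (Fin.ofNat n (t + i)) ≠ 0 := by
  intro h
  have h' : v (Fin.ofNat n (t + i + 1 + (n - 1))) = 0 := by
    rwa [show t + i + 1 + (n - 1) = t + i + n by omega, ofNat_add_period]
  rcases hexc.zero_neighbor hn hu hA hv h' with h3 | h3
  · exact hexc.no_adjacent_zeros hn hu hA hv h2 h1 (i := i) (by omega) h h3
  · rw [show t + i + 1 + (n - 2) = t + (i - 1) + n by omega, ofNat_add_period] at h3
    refine hexc.no_adjacent_zeros hn hu hA hv h2 h1 (i := i - 1) (by omega) h3 ?_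
    rwa [show i - 1 + 1 = i by omega]

/-- The kernel of the principal submatrix of `A` on the arc starting at `t`, as a space of vectors
supported on this arc. -/
def arcKernel (A : Matrix (Fin n) (Fin n) ℝ) (t : ℕ) : Submodule ℝ (Fin n → ℝ) where
  carrier := {x | x (Fin.ofNat n (t + (n - 2))) = 0 ∧ x (Fin.ofNat n (t + (n - 1))) = 0 ∧
    ∀ i < n - 2, (A *ᵥ x) (Fin.ofNat n (t + i)) = 0}
  add_mem' := by
    rintro x y ⟨h1, h2, h3⟩ ⟨h1', h2', h3'⟩
    refine ⟨?_, ?_, fun i hi => ?_⟩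
    · rw [Pi.add_apply, h1, h1', add_zero]
    · rw [Pi.add_apply, h2, h2', add_zero]
    · rw [mulVec_add, Pi.add_apply, h3 i hi, h3' i hi, add_zero]
  zero_mem' := ⟨rfl, rfl, fun i _ => by rw [mulVec_zero]; rfl⟩
  smul_mem' := by
    rintro c x ⟨h1, h2, h3⟩
    refine ⟨?_, ?_, fun i hi => ?_⟩
    · rw [Pi.smul_apply, h1, smul_zero]
    · rw [Pi.smul_apply, h2, smul_zero]
    · rw [mulVec_smul, Pi.smul_apply, h3 i hi, smul_zero]

theorem mem_arcKernel {t : ℕ} {x : Fin n → ℝ} :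
    x ∈ arcKernel A t ↔ x (Fin.ofNat n (t + (n - 2))) = 0 ∧ x (Fin.ofNat n (t + (n - 1))) = 0 ∧
      ∀ i < n - 2, (A *ᵥ x) (Fin.ofNat n (t + i)) = 0 := Iff.rfl

theorem IsZeroOf.mem_arcKernel (hn : 5 ≤ n) (hu : HasCirculantSupports u)
    (hA : A ∈ copositiveFace u) {v : Fin n → ℝ} (hv : IsZeroOf A v) {t : ℕ}
    (h2 : v (Fin.ofNat n (t + (n - 2))) = 0) (h1 : v (Fin.ofNat n (t + (n - 1))) = 0) :
    v ∈ arcKernel A t :=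
  ⟨h2, h1, fun _ hi => mulVec_eq_zero_of_support_arc hn hu hA hv h2 h1 hi⟩

theorem self_mem_arcKernel (hn : 5 ≤ n) (hu : HasCirculantSupports u)
    (hA : A ∈ copositiveFace u) (t : ℕ) : u (Fin.ofNat n t) ∈ arcKernel A t :=
  (isZeroOf_of_mem_face hn hu hA _).mem_arcKernel hn hu hA (hu.eq_zero t le_rfl (by omega))
    (hu.eq_zero t (by omega) (by omega))

theorem isZeroOf_of_mem_arcKernel {t : ℕ} {x : Fin n → ℝ} (hx : x ∈ arcKernel A t) (h0 : x ≠ 0)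
    (hpos : 0 ≤ x) : IsZeroOf A x := by
  refine ⟨h0, hpos, Finset.sum_eq_zero fun k _ => ?_⟩
  obtain ⟨i, hi, rfl⟩ := exists_eq_ofNat_add k t
  rcases lt_or_ge i (n - 2) with h | h
  · rw [hx.2.2 i h, mul_zero]
  · obtain rfl | rfl : i = n - 2 ∨ i = n - 1 := by omega
    · rw [hx.1, zero_mul]
    · rw [hx.2.1, zero_mul]

/-- A kernel vector on an arc with nonnegative end entries is nonnegative, with positive interior
entries. -/
theorem IsExceptional.nonneg_of_ends_nonneg (hn : 5 ≤ n) (hu : HasCirculantSupports u)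
    (hA : A ∈ copositiveFace u) (hexc : IsExceptional A) {t : ℕ} {x : Fin n → ℝ}
    (hx : x ∈ arcKernel A t) (h0 : x ≠ 0) (hl : 0 ≤ x (Fin.ofNat n t))
    (hr : 0 ≤ x (Fin.ofNat n (t + (n - 3)))) :
    0 ≤ x ∧ ∀ i, 0 < i → i < n - 3 → 0 < x (Fin.ofNat n (t + i)) := by
  have hpos : 0 ≤ x := by
    by_contra hneg
    obtain ⟨k, hk⟩ : ∃ k, x k < 0 := by
      by_contra h
      push Not at h
      exact hneg h
    -- Going from `u^t` in the direction `x`, the first entry to vanish is one where `x` is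
    -- negative, hence an interior one. The point reached is a zero of `A`, against
    -- `interior_ne_zero`.
    obtain ⟨c, hc, hc', k, hk, hk'⟩ :=
      exists_add_smul_boundary (hu (Fin.ofNat n t)).1 ⟨k, hk⟩
    have hmem : u (Fin.ofNat n t) + c • x ∈ arcKernel A t :=
      Submodule.add_mem _ (self_mem_arcKernel hn hu hA t) (Submodule.smul_mem _ _ hx)
    have hne : u (Fin.ofNat n t) + c • x ≠ 0 := by
      intro h
      have h1 := congrFun h (Fin.ofNat n t)
      have h2 := hu.pos_self hn (Fin.ofNat n t)
      have h3 := mul_nonneg hc hl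
      simp only [Pi.add_apply, Pi.smul_apply, smul_eq_mul, Pi.zero_apply] at h1
      linarith
    have hz := isZeroOf_of_mem_arcKernel hmem hne hc'
    obtain ⟨i, hi, rfl⟩ := exists_eq_ofNat_add k t
    have hi0 : i ≠ 0 := by
      rintro rfl
      rw [add_zero] at hk
      exact hk.not_ge hl
    have hi3 : i ≠ n - 3 := by
      rintro rfl
      exact hk.not_ge hr
    have hi2 : i ≠ n - 2 := by
      rintro rfl
      exact hk.ne hx.1
    have hi1 : i ≠ n - 1 := by
      rintro rfl
      exact hk.ne hx.2.1
    exact hexc.interior_ne_zero hn hu hA hz hmem.1 hmem.2.1 (i := i) (by omega) (by omega)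
      (by simpa using hk')
  refine ⟨hpos, fun i hi0 hi => lt_of_le_of_ne (hpos _) (Ne.symm ?_)⟩
  exact hexc.interior_ne_zero hn hu hA (isZeroOf_of_mem_arcKernel hx h0 hpos) hx.1 hx.2.1 hi0 hi

/-- Otherwise the interior entries of both `x` and `-x` would be positive. -/
theorem IsExceptional.eq_zero_of_ends_eq_zero (hn : 5 ≤ n) (hu : HasCirculantSupports u)
    (hA : A ∈ copositiveFace u) (hexc : IsExceptional A) {t : ℕ} {x : Fin n → ℝ}
    (hx : x ∈ arcKernel A t) (hl : x (Fin.ofNat n t) = 0)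
    (hr : x (Fin.ofNat n (t + (n - 3))) = 0) : x = 0 := by
  by_contra h0
  have h1 := (hexc.nonneg_of_ends_nonneg hn hu hA hx h0 hl.ge hr.ge).2 1 (by omega) (by omega)
  have h2 := (hexc.nonneg_of_ends_nonneg hn hu hA (Submodule.neg_mem _ hx) (neg_ne_zero.2 h0)
    (by rw [Pi.neg_apply, hl, neg_zero]) (by rw [Pi.neg_apply, hr, neg_zero])).2 1
    (by omega) (by omega)
  rw [Pi.neg_apply] at h2
  linarith

/-- The end entries of the vectors in the kernel on an arc. -/
def arcEnds (A : Matrix (Fin n) (Fin n) ℝ) (t : ℕ) : arcKernel A t →ₗ[ℝ] ℝ × ℝ :=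
  ((LinearMap.proj (Fin.ofNat n t)).prod (LinearMap.proj (Fin.ofNat n (t + (n - 3))))).comp
    (arcKernel A t).subtype

theorem IsExceptional.arcEnds_injective (hn : 5 ≤ n) (hu : HasCirculantSupports u)
    (hA : A ∈ copositiveFace u) (hexc : IsExceptional A) (t : ℕ) :
    Function.Injective (arcEnds A t) := by
  rw [injective_iff_map_eq_zero]
  intro x hx
  have h := Prod.ext_iff.1 hx
  exact Subtype.ext (hexc.eq_zero_of_ends_eq_zero hn hu hA x.2 h.1 h.2)

theorem IsExceptional.finrank_arcKernel_le (hn : 5 ≤ n) (hu : HasCirculantSupports u)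
    (hA : A ∈ copositiveFace u) (hexc : IsExceptional A) (t : ℕ) :
    Module.finrank ℝ (arcKernel A t) ≤ 2 := by
  have := LinearMap.finrank_le_finrank_of_injective (hexc.arcEnds_injective hn hu hA t)
  simpa using this

theorem matrixCorank_arcSubmatrix (hn : 5 ≤ n) (A : Matrix (Fin n) (Fin n) ℝ) (t : ℕ) :
    matrixCorank (arcSubmatrix A (Fin.ofNat n t)) = Module.finrank ℝ (arcKernel A t) := by
  have hinj : Function.Injective (arc n (Fin.ofNat n t)) := by
    intro i j h
    rw [arc_ofNat, arc_ofNat, ofNat_add_inj (by omega) (by omega)] at h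
    exact Fin.ext h
  let f : arcKernel A t →ₗ[ℝ] LinearMap.ker (arcSubmatrix A (Fin.ofNat n t)).mulVecLin :=
    ((LinearMap.funLeft ℝ ℝ (arc n (Fin.ofNat n t))).comp (arcKernel A t).subtype).codRestrict _
      (by
        intro x
        rw [LinearMap.mem_ker]
        ext i
        exact (arcSubmatrix_mulVec hn A t x.2.1 x.2.2.1 i).trans (x.2.2.2 i i.2))
  symm
  refine (LinearEquiv.ofBijective f ⟨?_, ?_⟩).finrank_eq
  · intro x y h
    apply Subtype.ext
    funext k
    obtain ⟨i, hi, rfl⟩ := exists_eq_ofNat_add k t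
    rcases lt_or_ge i (n - 2) with hi' | hi'
    · have := congrFun (congrArg Subtype.val h) ⟨i, hi'⟩
      change (x : Fin n → ℝ) (arc n _ _) = (y : Fin n → ℝ) (arc n _ _) at this
      rwa [arc_ofNat] at this
    · obtain rfl | rfl : i = n - 2 ∨ i = n - 1 := by omega
      · rw [x.2.1, y.2.1]
      · rw [x.2.2.1, y.2.2.1]
  · intro v
    set x : Fin n → ℝ := Function.extend (arc n (Fin.ofNat n t)) v 0 with hx
    have h2 : x (Fin.ofNat n (t + (n - 2))) = 0 :=
      Function.extend_apply' _ _ _ ((not_mem_arcSet_iff hn _ t).2 (Or.inl rfl))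
    have h1 : x (Fin.ofNat n (t + (n - 1))) = 0 :=
      Function.extend_apply' _ _ _ ((not_mem_arcSet_iff hn _ t).2 (Or.inr rfl))
    have hxv : x ∘ arc n (Fin.ofNat n t) = v := Function.extend_comp hinj _ _
    refine ⟨⟨x, h2, h1, fun i hi => ?_⟩, Subtype.ext hxv⟩
    rw [← arcSubmatrix_mulVec hn A t h2 h1 ⟨i, hi⟩, hxv]
    exact congrFun (LinearMap.mem_ker.1 v.2) _

theorem mem_arcKernel_iff_arcSum (hn : 5 ≤ n) (hu : HasCirculantSupports u) (A : matrixSpace u)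
    {t : ℕ} {x : Fin n → ℝ} (h2 : x (Fin.ofNat n (t + (n - 2))) = 0)
    (h1 : x (Fin.ofNat n (t + (n - 1))) = 0) :
    x ∈ arcKernel (A : Matrix (Fin n) (Fin n) ℝ) t ↔
      arcSum u t x ∈ LinearMap.ker (formOfMatrix hn hu A) := by
  rw [LinearMap.mem_ker]
  constructor
  · intro hx
    refine (windowBasis hn hu t).ext fun i => ?_
    rw [formOfMatrix_symm, windowBasis_apply, form_evalAt_arcSum hn hu A t h2 h1 (by omega),
      hx.2.2 i (by omega)]
    rfl
  · intro h
    refine ⟨h2, h1, fun i hi => ?_⟩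
    rw [← form_evalAt_arcSum hn hu A t h2 h1 hi, formOfMatrix_symm, h]
    rfl

/-- After cancelling the last entry by a multiple of `u^t`, a relation among the `n - 3` members of
a basis remains. -/
theorem exists_smul_eq_of_arcSum_eq_zero (hn : 5 ≤ n) (hu : HasCirculantSupports u) {t : ℕ}
    {x : Fin n → ℝ} (h2 : x (Fin.ofNat n (t + (n - 2))) = 0)
    (h1 : x (Fin.ofNat n (t + (n - 1))) = 0) (h : arcSum u t x = 0) :
    ∃ c : ℝ, c • u (Fin.ofNat n t) = x := by
  have hpos := hu.pos t (i := n - 3) (by omega)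
  set c := x (Fin.ofNat n (t + (n - 3))) / u (Fin.ofNat n t) (Fin.ofNat n (t + (n - 3))) with hc
  set y := x - c • u (Fin.ofNat n t) with hy
  have hy3 : y (Fin.ofNat n (t + (n - 3))) = 0 := by
    rw [hy, Pi.sub_apply, Pi.smul_apply, smul_eq_mul, hc, div_mul_cancel₀ _ hpos.ne', sub_self]
  have hy0 : arcSum u t y = 0 := by rw [hy, map_sub, map_smul, h, arcSum_self, smul_zero, sub_zero]
  rw [arcSum_apply, sum_smul_evalAt_split hn u t (fun i => y (Fin.ofNat n (t + i))), hy3,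
    zero_smul, add_zero] at hy0
  refine ⟨c, (sub_eq_zero.1 (funext fun k => ?_)).symm⟩
  change y k = 0
  obtain ⟨i, hi, rfl⟩ := exists_eq_ofNat_add k t
  rcases lt_or_ge i (n - 3) with h' | h'
  · exact window_coeff_eq_zero hn hu t hy0 h'
  · obtain rfl | rfl | rfl : i = n - 3 ∨ i = n - 2 ∨ i = n - 1 := by omega
    · exact hy3
    · rw [hy, Pi.sub_apply, Pi.smul_apply, h2, hu.eq_zero t le_rfl (by omega), smul_zero, sub_zero]
    · rw [hy, Pi.sub_apply, Pi.smul_apply, h1, hu.eq_zero t (by omega) (by omega), smul_zero,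
        sub_zero]

/-- The map `arcSum u t` sends the arc kernel onto the kernel of the form, and its own kernel is the
line of `u^t`. -/
theorem finrank_arcKernel (hn : 5 ≤ n) (hu : HasCirculantSupports u) (A : matrixSpace u) (t : ℕ) :
    Module.finrank ℝ (arcKernel (A : Matrix (Fin n) (Fin n) ℝ) t) =
      formCorank (formOfMatrix hn hu A) + 1 := by
  have := finiteDimensional_dual hn hu
  let f : arcKernel (A : Matrix (Fin n) (Fin n) ℝ) t →ₗ[ℝ]
      LinearMap.ker (formOfMatrix hn hu A) :=
    ((arcSum u t).comp (arcKernel (A : Matrix (Fin n) (Fin n) ℝ) t).subtype).codRestrict _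
      fun x => (mem_arcKernel_iff_arcSum hn hu A x.2.1 x.2.2.1).1 x.2
  have hsurj : LinearMap.range f = ⊤ := by
    rw [LinearMap.range_eq_top]
    intro w
    obtain ⟨x, hx, hxw⟩ := exists_arcSum_eq hn hu t w.1
    have h2 := hx (n - 2) (by omega) (by omega)
    have h1 := hx (n - 1) (by omega) (by omega)
    exact ⟨⟨x, (mem_arcKernel_iff_arcSum hn hu A h2 h1).2 (hxw ▸ w.2)⟩, Subtype.ext hxw⟩
  have hus : u (Fin.ofNat n t) ∈ arcKernel (A : Matrix (Fin n) (Fin n) ℝ) t := by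
    rw [mem_arcKernel_iff_arcSum hn hu A (hu.eq_zero t le_rfl (by omega))
      (hu.eq_zero t (by omega) (by omega)), arcSum_self]
    exact Submodule.zero_mem _
  have hker : Module.finrank ℝ (LinearMap.ker f) = 1 := by
    refine finrank_eq_one (⟨⟨u (Fin.ofNat n t), hus⟩, Subtype.ext (arcSum_self u t)⟩ :
      LinearMap.ker f) ?_ ?_
    · intro h
      have h1 := congrFun (congrArg (fun z : LinearMap.ker f => (z.1 : Fin n → ℝ)) h)
        (Fin.ofNat n t)
      exact (hu.pos_self hn _).ne' h1
    · intro x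
      obtain ⟨c, hc⟩ := exists_smul_eq_of_arcSum_eq_zero hn hu x.1.2.1 x.1.2.2.1
        (congrArg Subtype.val (LinearMap.mem_ker.1 x.2))
      exact ⟨c, Subtype.ext (Subtype.ext hc)⟩
  have hrank := LinearMap.finrank_range_add_finrank_ker (K := ℝ)
    (V₂ := LinearMap.ker (formOfMatrix hn hu A)) f
  rw [← hrank, hker, hsurj, finrank_top]
  rfl

end Zeros

/-! The case of a degenerate form. -/

section Degenerate

variable {n : ℕ} [NeZero n] {u : Fin n → Fin n → ℝ} {A : Matrix (Fin n) (Fin n) ℝ}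

theorem mem_face_of_add_left (hn : 5 ≤ n) (hu : HasCirculantSupports u)
    {X C : Matrix (Fin n) (Fin n) ℝ} (hX : IsCopositive X) (hC : IsCopositive C)
    (hA : X + C ∈ copositiveFace u) : X ∈ copositiveFace u :=
  ⟨hX, fun j => ((isZeroOf_of_mem_face hn hu hA j).of_add_left hX hC).2.2⟩

theorem support_subset_iff_ofNat (hn : 5 ≤ n) (v : Fin n → ℝ) (j : Fin n) :
    Function.support v ⊆ arcSet n j ↔
      v (Fin.ofNat n ((j : ℕ) + (n - 2))) = 0 ∧ v (Fin.ofNat n ((j : ℕ) + (n - 1))) = 0 := by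
  rw [← support_subset_arcSet_iff hn, ofNat_val_eq]

/-- In the degenerate case, the end entries of a kernel vector on an arc are arbitrary. -/
theorem IsExceptional.exists_mem_arcKernel (hn : 5 ≤ n) (hu : HasCirculantSupports u)
    (hA : A ∈ copositiveFace u) (hexc : IsExceptional A) {t : ℕ}
    (hrank : Module.finrank ℝ (arcKernel A t) = 2) (a b : ℝ) :
    ∃ x ∈ arcKernel A t, x (Fin.ofNat n t) = a ∧ x (Fin.ofNat n (t + (n - 3))) = b := by
  have hs : Function.Surjective (arcEnds A t) := by
    rw [← LinearMap.injective_iff_surjective_of_finrank_eq_finrank (by simp [hrank])]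
    exact hexc.arcEnds_injective hn hu hA t
  obtain ⟨x, hx⟩ := hs (a, b)
  exact ⟨x, x.2, (Prod.ext_iff.1 hx).1, (Prod.ext_iff.1 hx).2⟩

/-- The zero supported on the arc starting at `t` without its last element. -/
theorem IsExceptional.exists_left_zero (hn : 5 ≤ n) (hu : HasCirculantSupports u)
    (hA : A ∈ copositiveFace u) (hexc : IsExceptional A) {t : ℕ}
    (hrank : Module.finrank ℝ (arcKernel A t) = 2) :
    ∃ q ∈ arcKernel A t, IsZeroOf A q ∧ q (Fin.ofNat n t) = 1 ∧
      q (Fin.ofNat n (t + (n - 3))) = 0 := by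
  obtain ⟨q, hq, hl, hr⟩ := hexc.exists_mem_arcKernel hn hu hA hrank 1 0
  have h0 : q ≠ 0 := ne_zero_of_apply_eq_one hl
  exact ⟨q, hq, isZeroOf_of_mem_arcKernel hq h0 (hexc.nonneg_of_ends_nonneg hn hu hA hq h0
    (by rw [hl]; exact zero_le_one) hr.ge).1, hl, hr⟩

/-- The zero supported on the arc starting at `t` without its first element. -/
theorem IsExceptional.exists_right_zero (hn : 5 ≤ n) (hu : HasCirculantSupports u)
    (hA : A ∈ copositiveFace u) (hexc : IsExceptional A) {t : ℕ}
    (hrank : Module.finrank ℝ (arcKernel A t) = 2) :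
    ∃ p ∈ arcKernel A t, IsZeroOf A p ∧ p (Fin.ofNat n t) = 0 ∧
      p (Fin.ofNat n (t + (n - 3))) = 1 := by
  obtain ⟨p, hp, hl, hr⟩ := hexc.exists_mem_arcKernel hn hu hA hrank 0 1
  have h0 : p ≠ 0 := ne_zero_of_apply_eq_one hr
  exact ⟨p, hp, isZeroOf_of_mem_arcKernel hp h0 (hexc.nonneg_of_ends_nonneg hn hu hA hp h0
    hl.ge (by rw [hr]; exact zero_le_one)).1, hl, hr⟩

theorem IsExceptional.eq_of_ends_eq (hn : 5 ≤ n) (hu : HasCirculantSupports u)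
    (hA : A ∈ copositiveFace u) (hexc : IsExceptional A) {t : ℕ} {x y : Fin n → ℝ}
    (hx : x ∈ arcKernel A t) (hy : y ∈ arcKernel A t) (hl : x (Fin.ofNat n t) = y (Fin.ofNat n t))
    (hr : x (Fin.ofNat n (t + (n - 3))) = y (Fin.ofNat n (t + (n - 3)))) : x = y :=
  sub_eq_zero.1 (hexc.eq_zero_of_ends_eq_zero hn hu hA (Submodule.sub_mem _ hx hy)
    (by rw [Pi.sub_apply, hl, sub_self]) (by rw [Pi.sub_apply, hr, sub_self]))

/-- Interior entries of zeros never vanish, so a support is fixed by which ends vanish. If neither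
does, the left zero has smaller support; if one does, a zero of smaller support would vanish at both
ends. -/
theorem IsExceptional.isMinimalZeroOf_iff (hn : 5 ≤ n) (hu : HasCirculantSupports u)
    (hA : A ∈ copositiveFace u) (hexc : IsExceptional A) {t : ℕ}
    (hrank : Module.finrank ℝ (arcKernel A t) = 2) {v : Fin n → ℝ} (hv : IsZeroOf A v)
    (hmem : v ∈ arcKernel A t) :
    IsMinimalZeroOf A v ↔ v (Fin.ofNat n t) = 0 ∨ v (Fin.ofNat n (t + (n - 3))) = 0 := by
  have hint : ∀ w, IsZeroOf A w → w ∈ arcKernel A t → ∀ k, w k = 0 → v k ≠ 0 →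
      k = Fin.ofNat n t ∨ k = Fin.ofNat n (t + (n - 3)) := by
    intro w hw hwm k hk hvk
    obtain ⟨i, hi, rfl⟩ := exists_eq_ofNat_add k t
    by_contra hne
    push Not at hne
    have hi0 : i ≠ 0 := by
      rintro rfl
      exact hne.1 rfl
    have hi3 : i ≠ n - 3 := by
      rintro rfl
      exact hne.2 rfl
    have hi2 : i ≠ n - 2 := by
      rintro rfl
      exact hvk hmem.1
    have hi1 : i ≠ n - 1 := by
      rintro rfl
      exact hvk hmem.2.1
    exact hexc.interior_ne_zero hn hu hA hw hwm.1 hwm.2.1 (by omega) (by omega) hk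
  constructor
  · intro hmin
    by_contra hne
    push Not at hne
    obtain ⟨q, hq, hqz, hql, hqr⟩ := hexc.exists_left_zero hn hu hA hrank
    refine hmin.2 ⟨q, hqz, fun k hk => ?_, fun h => h hne.2 hqr⟩
    by_contra hvk
    rw [Function.notMem_support] at hvk
    obtain ⟨i, hi, rfl⟩ := exists_eq_ofNat_add k t
    have hi0 : i ≠ 0 := by
      rintro rfl
      exact hne.1 hvk
    have hi3 : i ≠ n - 3 := by
      rintro rfl
      exact hne.2 hvk
    have hi2 : i ≠ n - 2 := by
      rintro rfl
      exact hk hq.1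
    have hi1 : i ≠ n - 1 := by
      rintro rfl
      exact hk hq.2.1
    exact hexc.interior_ne_zero hn hu hA hv hmem.1 hmem.2.1 (by omega) (by omega) hvk
  · rintro hor
    refine ⟨hv, ?_⟩
    rintro ⟨w, hw, hsub, hne⟩
    have hz : ∀ k, v k = 0 → w k = 0 := by
      intro k hk
      by_contra h
      exact hsub h hk
    have hwm := hw.mem_arcKernel hn hu hA (hz _ hmem.1) (hz _ hmem.2.1)
    obtain ⟨k, hvk, hwk⟩ := Set.not_subset.1 hne
    rw [Function.notMem_support] at hwk
    refine hw.1 (hexc.eq_zero_of_ends_eq_zero hn hu hA hwm ?_ ?_)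
    · rcases hint w hw hwm k hwk hvk with rfl | rfl
      · exact hwk
      · exact hz _ (hor.resolve_right hvk)
    · rcases hint w hw hwm k hwk hvk with rfl | rfl
      · exact hz _ (hor.resolve_left hvk)
      · exact hwk

theorem not_three_zeros (hn : 5 ≤ n) (hu : HasCirculantSupports u) (j : Fin n) (t : ℕ)
    (h3 : u j (Fin.ofNat n (t + (n - 3))) = 0) (h2 : u j (Fin.ofNat n (t + (n - 2))) = 0)
    (h1 : u j (Fin.ofNat n (t + (n - 1))) = 0) : False := by
  rw [← ofNat_val_eq j, hu.eq_zero_iff, not_mem_arcSet_iff hn] at h1 h2 h3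
  have h12 : Fin.ofNat n (t + (n - 2)) ≠ Fin.ofNat n (t + (n - 1)) := by
    rw [Ne, ofNat_add_inj (by omega) (by omega)]
    omega
  have h13 : Fin.ofNat n (t + (n - 3)) ≠ Fin.ofNat n (t + (n - 1)) := by
    rw [Ne, ofNat_add_inj (by omega) (by omega)]
    omega
  have h23 : Fin.ofNat n (t + (n - 3)) ≠ Fin.ofNat n (t + (n - 2)) := by
    rw [Ne, ofNat_add_inj (by omega) (by omega)]
    omega
  rcases h1 with h1 | h1 <;> rcases h2 with h2 | h2 <;> rcases h3 with h3 | h3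
  · exact h12 (h2.trans h1.symm)
  · exact h12 (h2.trans h1.symm)
  · exact h13 (h3.trans h1.symm)
  · exact h23 (h3.trans h2.symm)
  · exact h23 (h3.trans h2.symm)
  · exact h13 (h3.trans h1.symm)
  · exact h12 (h2.trans h1.symm)
  · exact h12 (h2.trans h1.symm)

/-- The support of `q` lies in the arcs starting at `t` and at `t - 1`, which together omit only the
index `t + (n - 2)`. -/
theorem mulVec_left_zero_eq_zero (hn : 5 ≤ n) (hu : HasCirculantSupports u)
    (hA : A ∈ copositiveFace u) {t : ℕ} {q : Fin n → ℝ} (hq : IsZeroOf A q)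
    (h3 : q (Fin.ofNat n (t + (n - 3))) = 0) (h2 : q (Fin.ofNat n (t + (n - 2))) = 0)
    (h1 : q (Fin.ofNat n (t + (n - 1))) = 0) {k : Fin n} (hk : k ≠ Fin.ofNat n (t + (n - 2))) :
    (A *ᵥ q) k = 0 := by
  obtain ⟨i, hi, rfl⟩ := exists_eq_ofNat_add k t
  rw [Ne, ofNat_add_inj hi (by omega)] at hk
  rcases lt_or_ge i (n - 2) with h | h
  · exact mulVec_eq_zero_of_support_arc hn hu hA hq h2 h1 h
  · obtain rfl : i = n - 1 := by omega
    exact mulVec_eq_zero_of_support_arc hn hu hA hq (t := t + (n - 1)) (i := 0)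
      (by rwa [show t + (n - 1) + (n - 2) = t + (n - 3) + n by omega, ofNat_add_period])
      (by rwa [show t + (n - 1) + (n - 1) = t + (n - 2) + n by omega, ofNat_add_period]) (by omega)

/-- For the left zeros `q t`, both `A (q t)` and `X (q t)` are supported at the single index `t + (n
- 2)`, so they are proportional with ratio `d t`. Symmetry of `A` and `X` makes `d` constant, and
the `q t` suffice to determine `X`. -/
theorem IsExceptional.isExtremalCopositive_of_finrank_eq_two (hn : 5 ≤ n)
    (hu : HasCirculantSupports u) (hA : A ∈ copositiveFace u) (hexc : IsExceptional A)
    (hrank : ∀ t, Module.finrank ℝ (arcKernel A t) = 2) : IsExtremalCopositive A := by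
  refine isExtremalCopositive_of_forall hA.1 hexc.ne_zero fun X C hX hC hXC => ?_
  have hXf : X ∈ copositiveFace u := mem_face_of_add_left hn hu hX hC (hXC ▸ hA)
  choose q hq hqz hql hqr using fun t => hexc.exists_left_zero hn hu hA (hrank t)
  have hqX : ∀ t, IsZeroOf X (q t) := fun t => (hXC ▸ hqz t : IsZeroOf (X + C) _).of_add_left hX hC
  have hAq : ∀ t k, k ≠ Fin.ofNat n (t + (n - 2)) → (A *ᵥ q t) k = 0 := fun t k hk =>
    mulVec_left_zero_eq_zero hn hu hA (hqz t) (hqr t) (hq t).1 (hq t).2.1 hk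
  have hXq : ∀ t k, k ≠ Fin.ofNat n (t + (n - 2)) → (X *ᵥ q t) k = 0 := fun t k hk =>
    mulVec_left_zero_eq_zero hn hu hXf (hqX t) (hqr t) (hq t).1 (hq t).2.1 hk
  have hc : ∀ t, (A *ᵥ q t) (Fin.ofNat n (t + (n - 2))) ≠ 0 := by
    intro t h
    refine hexc.mulVec_ne_zero hn hu hA (hqz t) (funext fun k => ?_)
    by_cases hk : k = Fin.ofNat n (t + (n - 2))
    · rw [hk, h]
      rfl
    · exact hAq t k hk
  have hdot : ∀ t z, z ⬝ᵥ (A *ᵥ q t) = z (Fin.ofNat n (t + (n - 2))) *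
      (A *ᵥ q t) (Fin.ofNat n (t + (n - 2))) := by
    intro t z
    refine Finset.sum_eq_single _ (fun k _ hk => ?_) (by simp)
    rw [hAq t k hk, mul_zero]
  set d : ℕ → ℝ := fun t => (X *ᵥ q t) (Fin.ofNat n (t + (n - 2))) /
    (A *ᵥ q t) (Fin.ofNat n (t + (n - 2))) with hd
  have hXd : ∀ t, X *ᵥ q t = d t • (A *ᵥ q t) := by
    intro t
    ext k
    rw [Pi.smul_apply, smul_eq_mul]
    by_cases hk : k = Fin.ofNat n (t + (n - 2))
    · rw [hk, hd]
      exact (div_mul_cancel₀ _ (hc t)).symm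
    · rw [hXq t k hk, hAq t k hk, mul_zero]
  have hcomp : ∀ s t, q s (Fin.ofNat n (t + (n - 2))) ≠ 0 → d t = d s := by
    intro s t hne
    have h1 : q s ⬝ᵥ (X *ᵥ q t) = q t ⬝ᵥ (X *ᵥ q s) := dotProduct_mulVec_symm hX.1 _ _
    rw [hXd, hXd, dotProduct_smul, dotProduct_smul, dotProduct_mulVec_symm hA.1.1 (q t),
      hdot, smul_eq_mul, smul_eq_mul] at h1
    exact mul_right_cancel₀ (mul_ne_zero hne (hc t)) h1
  -- The place tested is `s` itself, and for `hd3` it is the interior place `s + 1`. Shifts by 2 and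
  -- by 3 generate the shift by 1.
  have hd2 : ∀ s, d (s + 2) = d s := by
    intro s
    refine hcomp s (s + 2) ?_
    rw [show s + 2 + (n - 2) = s + n by omega, ofNat_add_period, hql]
    exact one_ne_zero
  have hd3 : ∀ s, d (s + 3) = d s := by
    intro s
    refine hcomp s (s + 3) ?_
    rw [show s + 3 + (n - 2) = s + 1 + n by omega, ofNat_add_period]
    exact hexc.interior_ne_zero hn hu hA (hqz s) (hq s).1 (hq s).2.1 (by omega) (by omega)
  have hconst : ∀ s, d s = d 0 := by
    intro s
    induction s with
    | zero => rfl
    | succ s ih => rw [← ih, ← hd2 (s + 1), hd3 s]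
  -- Pairing `A z` with `q t` reads off the entry of `z` at `t + (n - 2)` up to a nonzero factor, so
  -- the products with all `q t` determine `z`.
  have hinj : Function.Injective A.mulVec := by
    have : Function.Injective A.mulVecLin := by
      rw [injective_iff_map_eq_zero]
      intro z hz
      ext k
      have h1 := hdot ((k : ℕ) + 2) z
      rw [dotProduct_mulVec_symm hA.1.1, show A *ᵥ z = 0 from hz, dotProduct_zero] at h1
      have h2 := (mul_eq_zero.1 h1.symm).resolve_right (hc _)
      rwa [show (k : ℕ) + 2 + (n - 2) = k + n by omega, ofNat_add_period, ofNat_val_eq] at h2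
    exact this
  have hsurj : Function.Surjective A.mulVec :=
    mulVec_surjective_iff_isUnit.2 (mulVec_injective_iff_isUnit.1 hinj)
  refine ⟨d 0, sub_eq_zero.1 ?_⟩
  have hY : ∀ t, (X - d 0 • A) *ᵥ q t = 0 := by
    intro t
    rw [sub_mulVec, smul_mulVec, hXd, hconst, sub_self]
  ext k l
  -- Each row of `X - d 0 • A` has the form `A z` and is orthogonal to all `q t`, hence `z = 0`.
  obtain ⟨z, hz⟩ := hsurj ((X - d 0 • A) k)
  have hz0 : z = 0 := by
    ext m
    have h1 := hdot ((m : ℕ) + 2) z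
    rw [dotProduct_mulVec_symm hA.1.1, show A *ᵥ z = _ from hz, dotProduct_comm,
      show (X - d 0 • A) k ⬝ᵥ q ((m : ℕ) + 2) = 0 from congrFun (hY _) k] at h1
    have h2 := (mul_eq_zero.1 h1.symm).resolve_right (hc _)
    rwa [show (m : ℕ) + 2 + (n - 2) = m + n by omega, ofNat_add_period, ofNat_val_eq] at h2
  rw [hz0] at hz
  rw [← hz, show A.mulVec 0 = 0 from mulVec_zero A]
  rfl

theorem IsExceptional.hasNonMinimal_of_finrank_eq_two (hn : 5 ≤ n)
    (hu : HasCirculantSupports u) (hA : A ∈ copositiveFace u) (hexc : IsExceptional A)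
    (hrank : ∀ t, Module.finrank ℝ (arcKernel A t) = 2) :
    HasNonMinimalCirculantZeroSupport A := by
  refine ⟨hexc, u, hu, isZeroOf_of_mem_face hn hu hA, fun h => ?_⟩
  -- This zero vanishes at three consecutive places, whereas each `u^j` vanishes at only two.
  obtain ⟨q, hq, hqz, -, hqr⟩ := hexc.exists_left_zero hn hu hA (hrank 0)
  obtain ⟨j, c, rfl⟩ := h q hqz
  have hc : c ≠ 0 := by
    rintro rfl
    exact hqz.1 (zero_smul _ _)
  refine not_three_zeros hn hu j 0 ?_ ?_ ?_
  · simpa [hc] using hqr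
  · simpa [hc] using hq.1
  · simpa [hc] using hq.2.1

theorem nonMinimalCase_of_formCorank_eq_one (hn : 5 ≤ n) (hu : HasCirculantSupports u)
    (hA : A ∈ copositiveFace u) (hexc : IsExceptional A) (hmem : A ∈ matrixSpace u)
    (hB : formCorank (formOfMatrix hn hu ⟨A, hmem⟩) = 1) :
    NonMinimalCase u A (formOfMatrix hn hu ⟨A, hmem⟩) := by
  have hrank : ∀ t, Module.finrank ℝ (arcKernel A t) = 2 := fun t => by
    rw [finrank_arcKernel hn hu ⟨A, hmem⟩ t, hB]
  have hmin := fun t v => hexc.isMinimalZeroOf_iff hn hu hA (hrank t) (v := v)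
  refine ⟨hexc.hasNonMinimal_of_finrank_eq_two hn hu hA hrank, hB, fun j => ?_, fun v hv => ?_,
    fun j => ?_, fun v hv hv' => ?_, hexc.isExtremalCopositive_of_finrank_eq_two hn hu hA hrank⟩
  · rw [← ofNat_val_eq j, matrixCorank_arcSubmatrix hn, hrank]
  · obtain ⟨t, h2, h1⟩ := hexc.exists_support_arc hn hu hA hv.1
    refine ⟨Fin.ofNat n t, (support_subset_arcSet_iff hn v t).2 ⟨h2, h1⟩, fun h => ?_⟩
    have hends := (hmin t v hv.1 (hv.1.mem_arcKernel hn hu hA h2 h1)).1 hv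
    rcases hends with h0 | h0
    · exact h ((ofNat_add_mem_arcSet (t := t) (i := 0) (by omega)).2 (by omega)) h0
    · exact h ((ofNat_add_mem_arcSet (t := t) (i := n - 3) (by omega)).2 (by omega)) h0
  · obtain ⟨q, hq, hqz, hql, hqr⟩ := hexc.exists_left_zero hn hu hA (hrank j)
    obtain ⟨p, hp, hpz, hpl, hpr⟩ := hexc.exists_right_zero hn hu hA (hrank j)
    have hset : {S ∈ minimalZeroSupports A | S ⊆ arcSet n j} =
        {Function.support q, Function.support p} := by
      ext S
      constructor
      · rintro ⟨⟨v, hv, rfl⟩, hsub⟩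
        obtain ⟨h2, h1⟩ := (support_subset_iff_ofNat hn v j).1 hsub
        have hvm := hv.1.mem_arcKernel hn hu hA h2 h1
        rcases (hmin j v hv.1 hvm).1 hv with h0 | h0
        · right
          have he : v = v (Fin.ofNat n ((j : ℕ) + (n - 3))) • p :=
            hexc.eq_of_ends_eq hn hu hA hvm (Submodule.smul_mem _ _ hp)
              (by rw [Pi.smul_apply, hpl, h0, smul_zero])
              (by rw [Pi.smul_apply, hpr, smul_eq_mul, mul_one])
          have hne : v (Fin.ofNat n ((j : ℕ) + (n - 3))) ≠ 0 := by
            intro h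
            rw [h, zero_smul] at he
            exact hv.1.1 he
          rw [he]
          exact Function.support_const_smul_of_ne_zero _ _ hne
        · left
          have he : v = v (Fin.ofNat n (j : ℕ)) • q :=
            hexc.eq_of_ends_eq hn hu hA hvm (Submodule.smul_mem _ _ hq)
              (by rw [Pi.smul_apply, hql, smul_eq_mul, mul_one])
              (by rw [Pi.smul_apply, hqr, h0, smul_zero])
          have hne : v (Fin.ofNat n (j : ℕ)) ≠ 0 := by
            intro h
            rw [h, zero_smul] at he
            exact hv.1.1 he
          rw [he]
          exact Function.support_const_smul_of_ne_zero _ _ hne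
      · rintro (rfl | rfl)
        · exact ⟨⟨q, (hmin j q hqz hq).2 (Or.inr hqr), rfl⟩,
            (support_subset_iff_ofNat hn q j).2 ⟨hq.1, hq.2.1⟩⟩
        · exact ⟨⟨p, (hmin j p hpz hp).2 (Or.inl hpl), rfl⟩,
            (support_subset_iff_ofNat hn p j).2 ⟨hp.1, hp.2.1⟩⟩
    rw [hset, Set.ncard_pair]
    intro h
    have : Fin.ofNat n (j : ℕ) ∈ Function.support p := by
      rw [← h, Function.mem_support, hql]
      exact one_ne_zero
    exact this hpl
  · obtain ⟨t, h2, h1⟩ := hexc.exists_support_arc hn hu hA hv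
    have hvm := hv.mem_arcKernel hn hu hA h2 h1
    rw [hmin t v hv hvm] at hv'
    push Not at hv'
    obtain ⟨q, hq, hqz, hql, hqr⟩ := hexc.exists_left_zero hn hu hA (hrank t)
    obtain ⟨p, hp, hpz, hpl, hpr⟩ := hexc.exists_right_zero hn hu hA (hrank t)
    have hl : 0 < v (Fin.ofNat n t) := lt_of_le_of_ne (hv.2.1 _) (Ne.symm hv'.1)
    have hr : 0 < v (Fin.ofNat n (t + (n - 3))) := lt_of_le_of_ne (hv.2.1 _) (Ne.symm hv'.2)
    refine ⟨⟨Fin.ofNat n t, ((support_subset_arcSet_iff hn v t).2 ⟨h2, h1⟩).antisymm ?_⟩,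
      v (Fin.ofNat n t) • q, v (Fin.ofNat n (t + (n - 3))) • p, ?_, ?_, ?_⟩
    · intro k hk
      obtain ⟨i, hi, rfl⟩ := exists_eq_ofNat_add k t
      rw [ofNat_add_mem_arcSet hi] at hk
      rw [Function.mem_support]
      rcases Nat.eq_zero_or_pos i with rfl | hi0
      · exact hv'.1
      · rcases lt_or_ge i (n - 3) with hi3 | hi3
        · exact hexc.interior_ne_zero hn hu hA hv h2 h1 hi0 hi3
        · obtain rfl : i = n - 3 := by omega
          exact hv'.2
    · exact (hmin t _ (hqz.smul hl) (Submodule.smul_mem _ _ hq)).2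
        (Or.inr (by rw [Pi.smul_apply, hqr, smul_zero]))
    · exact (hmin t _ (hpz.smul hr) (Submodule.smul_mem _ _ hp)).2
        (Or.inl (by rw [Pi.smul_apply, hpl, smul_zero]))
    · refine hexc.eq_of_ends_eq hn hu hA hvm
        (Submodule.add_mem _ (Submodule.smul_mem _ _ hq) (Submodule.smul_mem _ _ hp)) ?_ ?_
      · rw [Pi.add_apply, Pi.smul_apply, Pi.smul_apply, hql, hpl]
        simp
      · rw [Pi.add_apply, Pi.smul_apply, Pi.smul_apply, hqr, hpr]
        simp

end Degenerate

/-! Definite forms, and decreasing an exceptional form until its bilinear form degenerates. -/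

section DefiniteForms

variable {V : Type*} [AddCommGroup V] [Module ℝ V]

/-- The ratio of the two quadratic forms is continuous on the compact unit sphere, hence bounded,
and it is homogeneous of degree 0. -/
theorem exists_pos_smul_form_le {m : ℕ} (b : Module.Basis (Fin m) ℝ V)
    (B D : LinearMap.BilinForm ℝ V) (hB : ∀ w, w ≠ 0 → 0 < B w w) :
    ∃ ε : ℝ, 0 < ε ∧ ∀ w, ε * D w w ≤ B w w := by
  let e : (Fin m → ℝ) ≃ₗ[ℝ] V := b.equivFun.symm
  have hcont : ∀ F : LinearMap.BilinForm ℝ V, Continuous fun c : Fin m → ℝ => F (e c) (e c) := by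
    intro F
    have h : (fun c : Fin m → ℝ => F (e c) (e c)) = fun c =>
        c ⬝ᵥ (LinearMap.BilinForm.toMatrix' (F.comp e.toLinearMap e.toLinearMap) *ᵥ c) := by
      funext c
      rw [← Matrix.toBilin'_apply', Matrix.toBilin'_toMatrix']
      rfl
    rw [h]
    fun_prop
  have hpos : ∀ c ∈ Metric.sphere (0 : Fin m → ℝ) 1, 0 < B (e c) (e c) := by
    intro c hc
    refine hB _ fun h => ?_
    rw [LinearEquiv.map_eq_zero_iff] at h
    simp [h] at hc
  obtain ⟨K, hK⟩ := (isCompact_sphere (0 : Fin m → ℝ) 1).bddAbove_image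
    (f := fun c => D (e c) (e c) / B (e c) (e c))
    ((hcont D).continuousOn.div (hcont B).continuousOn fun c hc => (hpos c hc).ne')
  have hK0 : 0 < |K| + 1 := by positivity
  refine ⟨(|K| + 1)⁻¹, inv_pos.2 hK0, fun w => ?_⟩
  by_cases hw : w = 0
  · simp [hw]
  set c := e.symm w with hc
  have hwc : w = e c := by simp [hc]
  have hc0 : c ≠ 0 := by
    rintro h
    rw [h, map_zero] at hwc
    exact hw hwc
  have hn0 : 0 < ‖c‖ := norm_pos_iff.2 hc0
  have hs : ‖c‖⁻¹ • c ∈ Metric.sphere (0 : Fin m → ℝ) 1 := by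
    rw [mem_sphere_zero_iff_norm, norm_smul, norm_inv, norm_norm, inv_mul_cancel₀ hn0.ne']
  have h1 := hK (Set.mem_image_of_mem _ hs)
  have h2 := hpos _ hs
  simp only [map_smul, LinearMap.smul_apply, smul_eq_mul, ← hwc] at h1 h2
  rw [div_le_iff₀ h2] at h1
  have h3 : D w w ≤ K * B w w := by
    have h4 : 0 < ‖c‖⁻¹ * ‖c‖⁻¹ := by positivity
    refine le_of_mul_le_mul_left ?_ h4
    linarith
  rw [inv_mul_le_iff₀ hK0]
  refine h3.trans (mul_le_mul_of_nonneg_right ?_ (hB w hw).le)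
  linarith [le_abs_self K]

/-- The vector `w` minimises the quadratic form, so its derivative there vanishes in every
direction. -/
theorem mem_ker_of_form_self_eq_zero {B : LinearMap.BilinForm ℝ V} (hs : ∀ x y, B x y = B y x)
    (hB : ∀ w, 0 ≤ B w w) {w : V} (hw : B w w = 0) : w ∈ LinearMap.ker B := by
  have h : ∀ v, 0 ≤ B w v := by
    intro v
    refine nonneg_of_forall_quadratic_nonneg (b := B v v) fun t _ => ?_
    have h1 := hB (w + t • v)
    simp only [map_add, map_smul, LinearMap.add_apply, LinearMap.smul_apply, smul_eq_mul, hw,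
      hs v w] at h1
    linarith
  rw [LinearMap.mem_ker]
  ext v
  refine le_antisymm ?_ (h v)
  have := h (-v)
  rw [map_neg] at this
  change B w v ≤ 0
  linarith

theorem exists_spanning_of_formCorank_eq_one {B : LinearMap.BilinForm ℝ V}
    (h : formCorank B = 1) :
    ∃ w ∈ LinearMap.ker B, w ≠ 0 ∧ ∀ v ∈ LinearMap.ker B, ∃ c : ℝ, c • w = v := by
  have h1 : Module.finrank ℝ (LinearMap.ker B) = 1 := h
  obtain ⟨⟨w, hw⟩, hw0, hspan⟩ := finrank_eq_one_iff'.1 h1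
  refine ⟨w, hw, fun h => hw0 (Subtype.ext h), fun v hv => ?_⟩
  obtain ⟨c, hc⟩ := hspan ⟨v, hv⟩
  exact ⟨c, congrArg Subtype.val hc⟩

end DefiniteForms

/-! ### Subtracting members of the face from an exceptional form. -/

section Decrease

variable {n : ℕ} [NeZero n] {u : Fin n → Fin n → ℝ} {A : Matrix (Fin n) (Fin n) ℝ}

theorem isPosDefForm_of_formCorank_eq_zero (hn : 5 ≤ n) (hu : HasCirculantSupports u)
    (hA : A ∈ copositiveFace u) (hmem : A ∈ matrixSpace u)
    (hB : formCorank (formOfMatrix hn hu ⟨A, hmem⟩) = 0) :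
    IsPosDefForm (formOfMatrix hn hu ⟨A, hmem⟩) := by
  have := finiteDimensional_dual hn hu
  refine ⟨⟨fun x y => formOfMatrix_symm hn hu _ x y⟩, fun w hw => ?_⟩
  refine lt_of_le_of_ne (form_nonneg hn hu ⟨A, hmem⟩ hA w) fun h => hw ?_
  have h1 := mem_ker_of_form_self_eq_zero (formOfMatrix_symm hn hu ⟨A, hmem⟩)
    (form_nonneg hn hu ⟨A, hmem⟩ hA) h.symm
  rwa [Submodule.finrank_eq_zero.1 hB, Submodule.mem_bot] at h1

theorem IsExceptional.formCorank_le_one (hn : 5 ≤ n) (hu : HasCirculantSupports u)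
    (hA : A ∈ copositiveFace u) (hexc : IsExceptional A) (hmem : A ∈ matrixSpace u) :
    formCorank (formOfMatrix hn hu ⟨A, hmem⟩) ≤ 1 := by
  have h := hexc.finrank_arcKernel_le hn hu hA 0
  rw [finrank_arcKernel hn hu ⟨A, hmem⟩ 0] at h
  omega

/-- An exceptional form with a definite bilinear form lies in the relative interior of the face. -/
theorem IsExceptional.exists_sub_smul_isCopositive (hn : 5 ≤ n) (hu : HasCirculantSupports u)
    (hA : A ∈ copositiveFace u) (hexc : IsExceptional A) (hmem : A ∈ matrixSpace u)
    (hB : IsPosDefForm (formOfMatrix hn hu ⟨A, hmem⟩)) {X : Matrix (Fin n) (Fin n) ℝ}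
    (hX : X ∈ copositiveFace u) : ∃ ε : ℝ, 0 < ε ∧ IsCopositive (A - ε • X) := by
  have hXm := mem_matrixSpace_of_mem_face hn hu hX
  obtain ⟨ε, hε, h1⟩ := exists_pos_smul_form_le (evalBasis hn hu)
    (formOfMatrix hn hu ⟨A, hmem⟩) (formOfMatrix hn hu ⟨X, hXm⟩) hB.2
  -- On the arc both entries are zero; off the arc the entry of `A u^j` is positive and survives a
  -- small perturbation.
  have h2 : ∀ᶠ δ : ℝ in nhdsWithin 0 (Set.Ioi 0), ∀ j k, 0 ≤ ((A - δ • X) *ᵥ u j) k := by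
    rw [Filter.eventually_all]
    intro j
    rw [Filter.eventually_all]
    intro k
    have he : ∀ δ : ℝ, ((A - δ • X) *ᵥ u j) k = (A *ᵥ u j) k - δ * (X *ᵥ u j) k := by
      intro δ
      rw [sub_mulVec, smul_mulVec, Pi.sub_apply, Pi.smul_apply, smul_eq_mul]
    simp only [he]
    by_cases hk : k ∈ arcSet n j
    · refine Filter.Eventually.of_forall fun δ => ?_
      rw [mulVec_eq_zero_of_mem_arcSet hn hu hA hk, mulVec_eq_zero_of_mem_arcSet hn hu hX hk,
        mul_zero, sub_zero]
    · have hpos := hexc.mulVec_pos hn hu hA hk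
      have hc : Continuous fun δ : ℝ => (A *ᵥ u j) k - δ * (X *ᵥ u j) k := by fun_prop
      have h3 : ∀ᶠ δ : ℝ in nhds 0, 0 < (A *ᵥ u j) k - δ * (X *ᵥ u j) k :=
        hc.continuousAt.eventually_const_lt (by simpa using hpos)
      exact (h3.filter_mono nhdsWithin_le_nhds).mono fun δ hδ => hδ.le
  have h3 : ∀ᶠ δ : ℝ in nhdsWithin 0 (Set.Ioi 0), δ < ε :=
    (eventually_lt_nhds hε).filter_mono nhdsWithin_le_nhds
  obtain ⟨δ, ⟨hδ1, hδ2⟩, hδ3⟩ := ((h2.and h3).and self_mem_nhdsWithin).exists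
  have hδ0 : 0 < δ := hδ3
  refine ⟨δ, hδ0, ?_⟩
  refine isCopositive_of_form_nonneg hn hu (⟨A, hmem⟩ - δ • ⟨X, hXm⟩) (fun w => ?_)
    fun j k => hδ1 j k
  rw [map_sub, map_smul, LinearMap.sub_apply, LinearMap.sub_apply, LinearMap.smul_apply,
    LinearMap.smul_apply, smul_eq_mul, sub_nonneg]
  exact (mul_le_mul_of_nonneg_right hδ2.le (form_nonneg hn hu ⟨X, hXm⟩ hX w)).trans (h1 w)

/-- Subtract as large a multiple of `X` as possible from `A`. -/
theorem exists_maximal_sub_smul_mem_face (hn : 5 ≤ n) (hu : HasCirculantSupports u)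
    (hA : A ∈ copositiveFace u) {X : Matrix (Fin n) (Fin n) ℝ} (hX : X ∈ copositiveFace u)
    (h0 : X ≠ 0) : ∃ t : ℝ, 0 ≤ t ∧ A - t • X ∈ copositiveFace u ∧
      (IsExceptional (A - t • X) → ∀ hmem,
        formCorank (formOfMatrix hn hu ⟨A - t • X, hmem⟩) = 1) := by
  obtain ⟨t, ht, hmax⟩ := hA.1.exists_maximal_sub_smul hX.1 h0
  have hface : A - t • X ∈ copositiveFace u := by
    refine ⟨ht, fun j => ?_⟩
    rw [sub_mulVec, smul_mulVec, dotProduct_sub, dotProduct_smul, hA.2, hX.2, smul_zero, sub_zero]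
  refine ⟨t, hmax 0 (by simpa using hA.1), hface, fun hexc hmem => ?_⟩
  have h1 := hexc.formCorank_le_one hn hu hface hmem
  by_contra hne
  -- With a definite form a further multiple of `X` could be subtracted, against maximality.
  obtain ⟨ε, hε, hc⟩ := hexc.exists_sub_smul_isCopositive hn hu hface hmem
    (isPosDefForm_of_formCorank_eq_zero hn hu hface hmem (by omega)) hX
  have := hmax (t + ε) (by rwa [add_smul, ← sub_sub])
  linarith

/-- If `y` is orthogonal to all `u^j`, then a multiple of `y yᵀ` can be subtracted from an
exceptional form so that the bilinear form degenerates. -/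
theorem IsExceptional.exists_sub_vecMulVec (hn : 5 ≤ n) (hu : HasCirculantSupports u)
    (hA : A ∈ copositiveFace u) (hexc : IsExceptional A) {y : Fin n → ℝ} (hy : y ≠ 0)
    (hyu : ∀ j, y ⬝ᵥ u j = 0) : ∃ t : ℝ, 0 ≤ t ∧ A - t • vecMulVec y y ∈ copositiveFace u ∧
      IsExceptional (A - t • vecMulVec y y) ∧ ∀ hmem,
        formCorank (formOfMatrix hn hu ⟨A - t • vecMulVec y y, hmem⟩) = 1 := by
  have hmul : ∀ j, vecMulVec y y *ᵥ u j = 0 := by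
    intro j
    rw [vecMulVec_mulVec, hyu]
    simp
  have hX : vecMulVec y y ∈ copositiveFace u := by
    refine ⟨Matrix.PosSemidef.isCopositive ?_, fun j => by rw [hmul, dotProduct_zero]⟩
    simpa using posSemidef_vecMulVec_self_star y
  have hX0 : vecMulVec y y ≠ 0 := by
    intro h
    obtain ⟨k, hk⟩ := Function.ne_iff.1 hy
    have := congrFun (congrFun h k) k
    exact hk (mul_self_eq_zero.1 this)
  obtain ⟨t, ht, hface, hcor⟩ := exists_maximal_sub_smul_mem_face hn hu hA hX hX0
  have hexc' : IsExceptional (A - t • vecMulVec y y) := by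
    by_contra hne
    -- A non-exceptional member of the face annihilates `u^0`, but the subtraction leaves `A u^0 ≠
    -- 0` unchanged.
    have h1 := (posSemidef_of_not_isExceptional hn hu hface hne).2 (Fin.ofNat n 0)
    rw [sub_mulVec, smul_mulVec, hmul, smul_zero, sub_zero] at h1
    have h2 := hexc.mulVec_pos hn hu hA (j := Fin.ofNat n 0) (k := Fin.ofNat n (0 + (n - 2)))
      (by rw [ofNat_add_mem_arcSet (by omega)]; omega)
    rw [h1] at h2
    exact lt_irrefl _ h2
  exact ⟨t, ht, hface, hexc', hcor hexc'⟩

end Decrease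

/-! Eigenvalues of the monodromy. -/

section OddPeriod

variable {n : ℕ} [NeZero n] {u : Fin n → Fin n → ℝ} {A : Matrix (Fin n) (Fin n) ℝ}

/-- The functional `w` has positive coefficients in the basis `e_t, …, e_{t + d - 1}`. -/
def IsWindowPositive (u : Fin n → Fin n → ℝ) (t : ℕ)
    (w : Module.Dual ℝ (solutionSpace u)) : Prop :=
  ∃ x : Fin n → ℝ, (∀ i < n - 3, 0 < x (Fin.ofNat n (t + i))) ∧
    (∀ i, n - 3 ≤ i → i < n → x (Fin.ofNat n (t + i)) = 0) ∧ arcSum u t x = w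

theorem arcSum_succ (hn : 5 ≤ n) (u : Fin n → Fin n → ℝ) (t : ℕ) {x : Fin n → ℝ}
    (h0 : x (Fin.ofNat n t) = 0) (h2 : x (Fin.ofNat n (t + (n - 2))) = 0) :
    arcSum u t x = arcSum u (t + 1) x := by
  rw [arcSum_apply, arcSum_apply,
    sum_smul_evalAt_split_first hn u t (fun i => x (Fin.ofNat n (t + i))),
    sum_smul_evalAt_split hn u (t + 1) (fun i => x (Fin.ofNat n (t + 1 + i))), add_zero,
    show t + 1 + (n - 3) = t + (n - 2) by omega, h0, h2, zero_smul, zero_smul]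
  congr 1
  refine Finset.sum_congr rfl fun i _ => ?_
  rw [show t + (i + 1) = t + 1 + i by omega]

theorem arcSum_add_period (u : Fin n → Fin n → ℝ) (t : ℕ) (x : Fin n → ℝ) :
    arcSum u (t + n) x = (monodromy u).dualMap (arcSum u t x) := by
  rw [arcSum_apply, arcSum_apply, map_sum]
  refine Finset.sum_congr rfl fun i _ => ?_
  rw [map_smul, dualMap_monodromy_evalAt, show t + n + i = t + i + n by omega, ofNat_add_period]

theorem IsWindowPositive.dualMap {t : ℕ} {w : Module.Dual ℝ (solutionSpace u)}
    (h : IsWindowPositive u t w) : IsWindowPositive u (t + n) ((monodromy u).dualMap w) := by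
  obtain ⟨x, h1, h2, rfl⟩ := h
  refine ⟨x, fun i hi => ?_, fun i hi hi' => ?_, arcSum_add_period u t x⟩
  · rw [show t + n + i = t + i + n by omega, ofNat_add_period]
    exact h1 i hi
  · rw [show t + n + i = t + i + n by omega, ofNat_add_period]
    exact h2 i hi hi'

theorem IsWindowPositive.not_neg (hn : 5 ≤ n) (hu : HasCirculantSupports u) {t : ℕ}
    {w : Module.Dual ℝ (solutionSpace u)} (h : IsWindowPositive u t w) :
    ¬ IsWindowPositive u t (-w) := by
  rintro ⟨x', h1', h2', hx'⟩
  obtain ⟨x, h1, h2, rfl⟩ := h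
  have h0 : arcSum u t (x + x') = 0 := by rw [map_add, hx', add_neg_cancel]
  have hz : ∀ i, n - 3 ≤ i → i < n → (x + x') (Fin.ofNat n (t + i)) = 0 := by
    intro i hi hi'
    rw [Pi.add_apply, h2 i hi hi', h2' i hi hi', add_zero]
  obtain ⟨c, hc⟩ := exists_smul_eq_of_arcSum_eq_zero hn hu (hz (n - 2) (by omega) (by omega))
    (hz (n - 1) (by omega) (by omega)) h0
  have h3 := hz (n - 3) le_rfl (by omega)
  rw [← hc, Pi.smul_apply, smul_eq_mul] at h3
  have hc0 := (mul_eq_zero.1 h3).resolve_right (hu.pos t (by omega)).ne'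
  rw [hc0, zero_smul] at hc
  have h4 := congrFun hc (Fin.ofNat n (t + 0))
  have h5 := h1 0 (by omega)
  have h6 := h1' 0 (by omega)
  simp only [Pi.zero_apply, Pi.add_apply] at h4
  linarith

/-- The coordinates of `w` form an arc kernel vector with last entry zero, so the sign of its first
entry is the sign of all its interior entries. -/
theorem IsExceptional.isWindowPositive_or_neg (hn : 5 ≤ n) (hu : HasCirculantSupports u)
    (hA : A ∈ copositiveFace u) (hexc : IsExceptional A) (hmem : A ∈ matrixSpace u)
    {w : Module.Dual ℝ (solutionSpace u)}
    (hw : w ∈ LinearMap.ker (formOfMatrix hn hu ⟨A, hmem⟩)) (h0 : w ≠ 0) (t : ℕ) :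
    IsWindowPositive u t w ∨ IsWindowPositive u t (-w) := by
  have key : ∀ w ∈ LinearMap.ker (formOfMatrix hn hu ⟨A, hmem⟩), ∀ x : Fin n → ℝ,
      (∀ i, n - 3 ≤ i → i < n → x (Fin.ofNat n (t + i)) = 0) → arcSum u t x = w →
      0 < x (Fin.ofNat n t) → IsWindowPositive u t w := by
    rintro _ hw x hx rfl hpos
    have hxm : x ∈ arcKernel A t :=
      (mem_arcKernel_iff_arcSum hn hu ⟨A, hmem⟩ (hx (n - 2) (by omega) (by omega))
        (hx (n - 1) (by omega) (by omega))).2 hw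
    have hx0 : x ≠ 0 := by
      rintro rfl
      exact lt_irrefl _ hpos
    refine ⟨x, fun i hi => ?_, hx, rfl⟩
    rcases Nat.eq_zero_or_pos i with rfl | hi0
    · exact hpos
    · exact (hexc.nonneg_of_ends_nonneg hn hu hA hxm hx0 hpos.le
        (hx (n - 3) le_rfl (by omega)).ge).2 i hi0 hi
  obtain ⟨x, hx, hxw⟩ := exists_arcSum_eq hn hu t w
  rcases lt_trichotomy (x (Fin.ofNat n t)) 0 with h | h | h
  · right
    refine key _ (Submodule.neg_mem _ hw) (-x) (fun i hi hi' => ?_) (by rw [map_neg, hxw])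
      (by simpa using h)
    rw [Pi.neg_apply, hx i hi hi', neg_zero]
  · have hxm : x ∈ arcKernel A t :=
      (mem_arcKernel_iff_arcSum hn hu ⟨A, hmem⟩ (hx (n - 2) (by omega) (by omega))
        (hx (n - 1) (by omega) (by omega))).2 (hxw ▸ hw)
    rw [hexc.eq_zero_of_ends_eq_zero hn hu hA hxm h (hx (n - 3) le_rfl (by omega)), map_zero] at hxw
    exact absurd hxw.symm h0
  · exact Or.inl (key w hw x hx hxw h)

/-- If both coordinate vectors `x` and `x'` were positive, `x - x'` would be a multiple `c • u^t`.
Its first entry gives `c > 0`, but its last entry is negative. -/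
theorem IsExceptional.isWindowPositive_succ (hn : 5 ≤ n) (hu : HasCirculantSupports u)
    (hA : A ∈ copositiveFace u) (hexc : IsExceptional A) (hmem : A ∈ matrixSpace u)
    {w : Module.Dual ℝ (solutionSpace u)}
    (hw : w ∈ LinearMap.ker (formOfMatrix hn hu ⟨A, hmem⟩)) (h0 : w ≠ 0) {t : ℕ}
    (h : IsWindowPositive u t w) : IsWindowPositive u (t + 1) (-w) := by
  refine (hexc.isWindowPositive_or_neg hn hu hA hmem hw h0 (t + 1)).resolve_left ?_
  rintro ⟨x', h1', h2', hx'⟩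
  obtain ⟨x, h1, h2, rfl⟩ := h
  have e0 : x' (Fin.ofNat n t) = 0 := by
    have := h2' (n - 1) (by omega) (by omega)
    rwa [show t + 1 + (n - 1) = t + n by omega, ofNat_add_period] at this
  have e1 : x' (Fin.ofNat n (t + (n - 1))) = 0 := by
    have := h2' (n - 2) (by omega) (by omega)
    rwa [show t + 1 + (n - 2) = t + (n - 1) by omega] at this
  have e2 : x' (Fin.ofNat n (t + (n - 2))) = 0 := by
    have := h2' (n - 3) (by omega) (by omega)
    rwa [show t + 1 + (n - 3) = t + (n - 2) by omega] at this
  have e3 : 0 < x' (Fin.ofNat n (t + (n - 3))) := by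
    have := h1' (n - 4) (by omega)
    rwa [show t + 1 + (n - 4) = t + (n - 3) by omega] at this
  have hz : arcSum u t (x - x') = 0 := by
    rw [map_sub, arcSum_succ hn u t e0 e2, hx', sub_self]
  obtain ⟨c, hc⟩ := exists_smul_eq_of_arcSum_eq_zero hn hu
    (by rw [Pi.sub_apply, h2 (n - 2) (by omega) (by omega), e2, sub_zero])
    (by rw [Pi.sub_apply, h2 (n - 1) (by omega) (by omega), e1, sub_zero]) hz
  have f0 := congrFun hc (Fin.ofNat n t)
  have f3 := congrFun hc (Fin.ofNat n (t + (n - 3)))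
  have g0 := h1 0 (by omega)
  rw [add_zero] at g0
  rw [Pi.smul_apply, Pi.sub_apply, smul_eq_mul, e0, sub_zero] at f0
  rw [Pi.smul_apply, Pi.sub_apply, smul_eq_mul, h2 (n - 3) le_rfl (by omega)] at f3
  have hc0 : 0 < c := pos_of_mul_pos_left (by rw [f0]; exact g0) (hu.pos_self hn _).le
  have := mul_pos hc0 (hu.pos t (i := n - 3) (by omega))
  linarith

/-- For odd `n`, the kernel of a degenerate exceptional form is an eigenspace of the dual of the
monodromy with a negative eigenvalue, which is `-1` if there is an invariant definite form. -/
theorem IsExceptional.hasEigenvalue_neg_one (hn : 5 ≤ n) (hodd : Odd n)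
    (hu : HasCirculantSupports u) (hA : A ∈ copositiveFace u) (hexc : IsExceptional A)
    (hmem : A ∈ matrixSpace u) (hcor : formCorank (formOfMatrix hn hu ⟨A, hmem⟩) = 1)
    (D : matrixSpace u) (hD : IsPosDefForm (formOfMatrix hn hu D)) :
    (monodromy u).HasEigenvalue (-1) := by
  obtain ⟨w, hw, hw0, hspan⟩ := exists_spanning_of_formCorank_eq_one hcor
  have hMmem : (monodromy u).dualMap w ∈ LinearMap.ker (formOfMatrix hn hu ⟨A, hmem⟩) := by
    refine mem_ker_of_form_self_eq_zero (formOfMatrix_symm hn hu ⟨A, hmem⟩)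
      (form_nonneg hn hu ⟨A, hmem⟩ hA) ?_
    rw [form_dualMap, LinearMap.mem_ker.1 hw]
    rfl
  obtain ⟨c, hc⟩ := hspan _ hMmem
  -- Invariance of the definite form `D` fixes the absolute value of the eigenvalue.
  have hcc : c * c = 1 := by
    have h1 := form_dualMap hn hu D w w
    rw [← hc, map_smul, map_smul, LinearMap.smul_apply, smul_eq_mul, smul_eq_mul, ← mul_assoc] at h1
    exact mul_right_cancel₀ (hD.2 w hw0).ne' (h1.trans (one_mul _).symm)
  -- Moving the window through a full period changes the sign an odd number of times, which excludes
  -- the eigenvalue 1.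
  have hneg : ∀ v ∈ LinearMap.ker (formOfMatrix hn hu ⟨A, hmem⟩), v ≠ 0 →
      IsWindowPositive u 0 v → (monodromy u).dualMap v ≠ v := by
    intro v hv hv0 hpos heq
    have hiter : ∀ m, IsWindowPositive u m ((-1 : ℝ) ^ m • v) := by
      intro m
      induction m with
      | zero => simpa using hpos
      | succ m ih =>
        have := hexc.isWindowPositive_succ hn hu hA hmem (Submodule.smul_mem _ _ hv)
          (smul_ne_zero (pow_ne_zero _ (by norm_num)) hv0) ih
        rwa [← neg_smul, show -(-1 : ℝ) ^ m = (-1) ^ (m + 1) by rw [pow_succ]; ring] at this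
    have h1 := hiter n
    have h3 : (-1 : ℝ) ^ n • v = -v := by
      rw [hodd.neg_one_pow]
      exact neg_one_smul ℝ v
    rw [h3] at h1
    have h2 := hpos.dualMap
    rw [zero_add, heq] at h2
    exact h2.not_neg hn hu h1
  have hc1 : c = -1 := by
    rcases mul_self_eq_one_iff.1 hcc with rfl | h
    · exfalso
      rw [one_smul] at hc
      rcases hexc.isWindowPositive_or_neg hn hu hA hmem hw hw0 0 with h | h
      · exact hneg w hw hw0 h hc.symm
      · exact hneg (-w) (Submodule.neg_mem _ hw) (neg_ne_zero.2 hw0) h (by rw [map_neg, ← hc])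
    · exact h
  rw [hc1, neg_one_smul] at hc
  have : FiniteDimensional ℝ (solutionSpace u) :=
    Module.Basis.finiteDimensional_of_finite (solutionBasis hn hu)
  by_contra hne
  -- If `-1` were not an eigenvalue, `f` would be surjective; but `w` vanishes on its range.
  let f : Module.End ℝ (solutionSpace u) := monodromy u + LinearMap.id
  have hinj : Function.Injective f := by
    rw [injective_iff_map_eq_zero]
    intro x hx
    by_contra hx0
    refine hne (Module.End.hasEigenvalue_of_hasEigenvector (x := x)
      (Module.End.hasEigenvector_iff.2 ⟨Module.End.mem_eigenspace_iff.2 ?_, hx0⟩))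
    rw [neg_one_smul]
    exact eq_neg_of_add_eq_zero_left hx
  refine hw0 (LinearMap.ext fun y => ?_)
  obtain ⟨x, rfl⟩ := LinearMap.surjective_of_injective hinj y
  have h1 : -(w x) = w (monodromy u x) := congrArg (fun g : Module.Dual ℝ _ => g x) hc
  change w (monodromy u x + x) = 0
  rw [map_add, ← h1, neg_add_cancel]

end OddPeriod

/-! ### Even period: orientation and the eigenvalue 1. -/

section EvenPeriod

variable {n : ℕ} [NeZero n] {u : Fin n → Fin n → ℝ}

/-- Shifting the window of vectors in an alternating map along a linear relation. -/
theorem AlternatingMap.window_shift {V : Type*} [AddCommGroup V] [Module ℝ V] {m : ℕ}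
    (D : V [⋀^Fin (m + 1)]→ₗ[ℝ] ℝ) (E : ℕ → V) (r : ℕ → ℝ)
    (h : ∑ i ∈ Finset.range (m + 2), r i • E i = 0) :
    r 0 * ((-1) ^ m * D fun i => E i) + r (m + 1) * D (fun i => E (i + 1)) = 0 := by
  set v : Fin (m + 1) → V := fun i => E (i + 1) with hv
  -- With `E 1, …, E m` in the other slots, only `E 0` and `E (m + 1)` contribute; bringing `E 0` to
  -- the front is a cyclic rotation of sign `(-1) ^ m`.
  let φ : V →ₗ[ℝ] ℝ := D.toMultilinearMap.toLinearMap v (Fin.last m)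
  have hφ : ∀ z, φ z = D (Function.update v (Fin.last m) z) := fun z => rfl
  have h1 : ∑ i ∈ Finset.range (m + 2), r i * φ (E i) = 0 := by
    have := congrArg φ h
    simpa using this
  have hmid : ∀ i ∈ Finset.range m, r (i + 1) * φ (E (i + 1)) = 0 := by
    intro i hi
    rw [Finset.mem_range] at hi
    rw [hφ, D.map_eq_zero_of_eq _ (i := ⟨i, by omega⟩) (j := Fin.last m), mul_zero]
    · rw [Function.update_self, Function.update_of_ne]
      intro h
      exact hi.ne (congrArg Fin.val h)
    · intro h
      exact hi.ne (congrArg Fin.val h)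
  have hlast : φ (E (m + 1)) = D v := by
    rw [hφ]
    congr 1
    exact Function.update_eq_self _ _
  have hfirst : φ (E 0) = (-1) ^ m * D fun i => E i := by
    have hrot : Function.update v (Fin.last m) (E 0) =
        (fun i : Fin (m + 1) => E i) ∘ finRotate (m + 1) := by
      funext i
      refine Fin.lastCases ?_ (fun i => ?_) i
      · rw [Function.update_self, Function.comp, finRotate_last]
        rfl
      · rw [Function.update_of_ne (Fin.castSucc_lt_last i).ne, Function.comp,
          show i.castSucc = ⟨i, i.2.trans (Nat.lt_succ_self m)⟩ from rfl, finRotate_of_lt i.2]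
    rw [hφ, hrot, D.map_perm, sign_finRotate]
    simp [Units.smul_def]
  rw [Finset.sum_range_succ, Finset.sum_range_succ', Finset.sum_eq_zero hmid, zero_add, hlast,
    hfirst] at h1
  exact h1

/-- For even `n` the monodromy preserves the orientation. -/
theorem det_monodromy_pos (hn : 5 ≤ n) (heven : Even n) (hu : HasCirculantSupports u) :
    0 < LinearMap.det (monodromy u).dualMap := by
  set D : ℕ → ℝ := fun t => (evalBasis hn hu).det fun i : Fin (n - 3) => evalAt u (t + i) with hD
  have hb : (fun i : Fin (n - 3) => evalAt u (0 + i)) = evalBasis hn hu := by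
    funext i
    rw [evalBasis_apply, zero_add]
  have hD0 : D 0 = 1 := by
    rw [hD]
    dsimp only
    rw [hb, Module.Basis.det_self]
  have hDn : D n = LinearMap.det (monodromy u).dualMap := by
    have h1 := (evalBasis hn hu).det_comp (monodromy u).dualMap (evalBasis hn hu)
    rw [Module.Basis.det_self, mul_one] at h1
    rw [← h1, hD]
    dsimp only
    congr 1
    funext i
    rw [Function.comp, evalBasis_apply, dualMap_monodromy_evalAt, add_comm]
  -- Here `m = n - 4` is even and both end coefficients of `u^t` are positive, so the determinants
  -- of consecutive windows have opposite signs; `n` steps then restore the sign.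
  have hstep : ∀ t, D t * D (t + 1) < 0 ∨ D t = 0 := by
    intro t
    have key : ∀ m (e : n - 3 = m + 1),
        u (Fin.ofNat n t) (Fin.ofNat n (t + 0)) * ((-1) ^ m * D t) +
          u (Fin.ofNat n t) (Fin.ofNat n (t + (m + 1))) * D (t + 1) = 0 := by
      intro m e
      have h2 := sum_smul_evalAt_eq_zero u t
      rw [show n - 2 = m + 2 by omega] at h2
      have h3 := AlternatingMap.window_shift
        ((evalBasis hn hu).det.domDomCongr (finCongr e)) (fun i => evalAt u (t + i))
        (fun i => u (Fin.ofNat n t) (Fin.ofNat n (t + i))) h2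
      have e1 : ((evalBasis hn hu).det.domDomCongr (finCongr e))
          (fun i : Fin (m + 1) => evalAt u (t + i)) = D t := rfl
      have e2 : ((evalBasis hn hu).det.domDomCongr (finCongr e))
          (fun i : Fin (m + 1) => evalAt u (t + (i + 1))) = D (t + 1) := by
        rw [hD]
        simp only [AlternatingMap.domDomCongr_apply]
        congr 1
        funext i
        change evalAt u (t + (i + 1)) = evalAt u (t + 1 + i)
        rw [show t + ((i : ℕ) + 1) = t + 1 + i by omega]
      rwa [e1, e2] at h3
    have h4 := key (n - 4) (by omega)
    have hev : Even (n - 4) := by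
      obtain ⟨k, hk⟩ := heven
      exact ⟨k - 2, by omega⟩
    rw [hev.neg_one_pow, one_mul] at h4
    have h5 := hu.pos t (i := 0) (by omega)
    have h6 := hu.pos t (i := n - 4 + 1) (by omega)
    by_cases h0 : D t = 0
    · exact Or.inr h0
    · left
      have h7 : 0 < D t * D t := mul_self_pos.2 h0
      have h8 := mul_pos h5 h7
      have h9 : u (Fin.ofNat n t) (Fin.ofNat n (t + (n - 4 + 1))) * (D t * D (t + 1)) < 0 := by
        have : u (Fin.ofNat n t) (Fin.ofNat n (t + (n - 4 + 1))) * (D t * D (t + 1)) =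
            -(u (Fin.ofNat n t) (Fin.ofNat n (t + 0)) * (D t * D t)) := by
          linear_combination D t * h4
        linarith
      exact (mul_neg_iff.1 h9).elim (fun h => h.2) fun h => absurd h.1 h6.not_gt
  have hsign : ∀ t, 0 < (-1) ^ t * D t := by
    intro t
    induction t with
    | zero => rw [hD0]; norm_num
    | succ t ih =>
      have hne : D t ≠ 0 := by
        intro h
        rw [h, mul_zero] at ih
        exact lt_irrefl _ ih
      have h1 := (hstep t).resolve_right hne
      have h2 : (-1 : ℝ) ^ t * (-1) ^ t = 1 := by
        rw [← mul_pow]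
        norm_num
      have h3 : ((-1) ^ t * D t) * ((-1) ^ (t + 1) * D (t + 1)) = -(D t * D (t + 1)) := by
        rw [pow_succ]
        linear_combination (-(D t * D (t + 1))) * h2
      exact pos_of_mul_pos_right (by rw [h3]; linarith) ih.le
  have := hsign n
  rwa [heven.neg_one_pow, one_mul, hDn] at this

/-- For even `n`, if there is an invariant definite form, then the system has a periodic
solution. -/
theorem exists_periodic_solution (hn : 5 ≤ n) (heven : Even n) (hu : HasCirculantSupports u)
    (A : matrixSpace u) (hA : IsPosDefForm (formOfMatrix hn hu A)) :
    ∃ y : Fin n → ℝ, y ≠ 0 ∧ ∀ j, y ⬝ᵥ u j = 0 := by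
  have : FiniteDimensional ℝ (solutionSpace u) :=
    Module.Basis.finiteDimensional_of_finite (solutionBasis hn hu)
  set b := evalBasis hn hu with hb
  set B := formOfMatrix hn hu A with hB
  set G := LinearMap.BilinForm.toMatrix b B with hG
  set N := LinearMap.toMatrix b b (monodromy u).dualMap with hN
  have hGN : Nᵀ * G * N = G := by
    have h : B.comp (monodromy u).dualMap (monodromy u).dualMap = B := by
      ext x y
      exact form_dualMap hn hu A _ _
    rw [hG, hN, ← LinearMap.BilinForm.toMatrix_comp, h]
  have hG0 : G.det ≠ 0 := by
    intro h
    obtain ⟨c, hc0, hc⟩ := Matrix.exists_mulVec_eq_zero_iff.2 h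
    have hpos := hA.2 (b.equivFun.symm c) (by rwa [Ne, LinearEquiv.map_eq_zero_iff])
    have h1 : B (b.equivFun.symm c) (b.equivFun.symm c) = c ⬝ᵥ (G *ᵥ c) := by
      rw [hG, ← LinearMap.BilinForm.dotProduct_toMatrix_mulVec]
    rw [h1, hc, dotProduct_zero] at hpos
    exact lt_irrefl _ hpos
  have hdet : N.det = 1 := by
    have h1 := det_monodromy_pos hn heven hu
    rw [← LinearMap.det_toMatrix b] at h1
    have h2 := congrArg Matrix.det hGN
    rw [det_mul, det_mul, det_transpose] at h2
    have h3 : N.det * N.det = 1 := mul_right_cancel₀ hG0 (by linear_combination h2)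
    rcases mul_self_eq_one_iff.1 h3 with h | h
    · exact h
    · rw [← hN, h] at h1
      norm_num at h1
  have hdet1 : (N - 1).det = 0 := by
    -- As `N.det = 1` and the size `n - 3` is odd, taking determinants gives `det (N - 1) = -det (N
    -- - 1)`.
    have h1 : Nᵀ * G * (N - 1) = -((N - 1)ᵀ * G) := by
      rw [mul_sub, hGN, mul_one, transpose_sub, transpose_one, sub_mul, one_mul, neg_sub]
    have h2 := congrArg Matrix.det h1
    have hd : Odd (n - 3) := by
      obtain ⟨k, hk⟩ := heven
      exact ⟨k - 2, by omega⟩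
    rw [det_mul, det_mul, det_transpose, det_neg, det_mul, det_transpose, hdet, Fintype.card_fin,
      hd.neg_one_pow, one_mul] at h2
    have h3 : G.det * (2 * (N - 1).det) = 0 := by linear_combination h2
    have := (mul_eq_zero.1 h3).resolve_left hG0
    linarith
  have hdetM : LinearMap.det (monodromy u - 1) = 0 := by
    rw [← LinearMap.det_dualMap, ← LinearMap.det_toMatrix b, ← hdet1]
    congr 1
    have : (monodromy u - 1).dualMap = (monodromy u).dualMap - LinearMap.id := by
      ext f x
      simp [LinearMap.dualMap_apply]
    ext i j
    rw [this, hN, LinearMap.toMatrix_apply, Matrix.sub_apply, LinearMap.toMatrix_apply, one_apply,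
      LinearMap.sub_apply, map_sub, Finsupp.sub_apply, LinearMap.id_apply, b.repr_self,
      Finsupp.single_apply]
    simp only [eq_comm]
  obtain ⟨x, hx, hx0⟩ := (Submodule.ne_bot_iff _).1 (LinearMap.bot_lt_ker_of_det_eq_zero hdetM).ne'
  have hper : Function.Periodic (x : ℕ → ℝ) n := by
    intro t
    have h1 : monodromy u x = x := sub_eq_zero.1 hx
    exact congrFun (congrArg Subtype.val h1) t
  have hy : ∀ t, (x : ℕ → ℝ) ((Fin.ofNat n t : Fin n) : ℕ) = (x : ℕ → ℝ) t :=
    fun t => hper.map_mod_nat t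
  refine ⟨fun k => (x : ℕ → ℝ) k, fun h => hx0 (Subtype.ext (funext fun t => ?_)), fun j => ?_⟩
  · rw [← hy]
    exact congrFun h _
  · rw [← ofNat_val_eq j]
    have h1 := congrArg (fun w => w x) (sum_smul_evalAt_eq_zero u (j : ℕ))
    rw [dotProduct, sum_eq_sum_range_arc hn _ (j : ℕ)
      (by rw [hu.eq_zero _ le_rfl (by omega), mul_zero])
      (by rw [hu.eq_zero _ (by omega) (by omega), mul_zero])]
    simp only [LinearMap.sum_apply, LinearMap.smul_apply, LinearMap.zero_apply] at h1
    rw [← h1]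
    refine Finset.sum_congr rfl fun i _ => ?_
    rw [hy, mul_comm]
    rfl

end EvenPeriod

/-! The two cases. -/

section Cases

variable {n : ℕ} [NeZero n] {u : Fin n → Fin n → ℝ} {A : Matrix (Fin n) (Fin n) ℝ}

theorem IsZeroOf.exists_smul_eq (hn : 5 ≤ n) (hu : HasCirculantSupports u)
    (hA : A ∈ copositiveFace u)
    (hrank : ∀ t, Module.finrank ℝ (arcKernel A t) = 1) {v : Fin n → ℝ} (hv : IsZeroOf A v)
    {t : ℕ} (h2 : v (Fin.ofNat n (t + (n - 2))) = 0) (h1 : v (Fin.ofNat n (t + (n - 1))) = 0) :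
    ∃ c : ℝ, 0 < c ∧ v = c • u (Fin.ofNat n t) := by
  have hus := self_mem_arcKernel hn hu hA t
  have hne : (⟨_, hus⟩ : arcKernel A t) ≠ 0 := fun h =>
    (hu.pos_self hn (Fin.ofNat n t)).ne' (congrFun (congrArg Subtype.val h) (Fin.ofNat n t))
  obtain ⟨c, hc⟩ := exists_smul_eq_of_finrank_eq_one (hrank t) hne
    ⟨v, hv.mem_arcKernel hn hu hA h2 h1⟩
  replace hc : c • u (Fin.ofNat n t) = v := congrArg Subtype.val hc
  refine ⟨c, lt_of_le_of_ne ?_ ?_, hc.symm⟩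
  · have h3 : 0 ≤ c * u (Fin.ofNat n t) (Fin.ofNat n t) := by
      have := hv.2.1 (Fin.ofNat n t)
      rwa [← hc] at this
    exact nonneg_of_mul_nonneg_left h3 (hu.pos_self hn _)
  · rintro rfl
    exact hv.1 (by rw [← hc, zero_smul])

/-- The face has no degenerate exceptional member, so the maximal subtraction of `X` from `A` ends
at a positive semi-definite matrix annihilating all `u^j`. A nonzero row `y` of it would allow a
multiple of `y yᵀ` to be subtracted from `A` down to a degenerate exceptional form. -/
theorem IsExceptional.isExtremalCopositive_of_odd (hn : 5 ≤ n) (hodd : Odd n)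
    (hu : HasCirculantSupports u) (hA : A ∈ copositiveFace u) (hexc : IsExceptional A)
    (hmem : A ∈ matrixSpace u) (hB : IsPosDefForm (formOfMatrix hn hu ⟨A, hmem⟩))
    (hM : ¬ (monodromy u).HasEigenvalue (-1)) : IsExtremalCopositive A := by
  refine isExtremalCopositive_of_forall hA.1 hexc.ne_zero fun X C hX hC hXC => ?_
  have hXf : X ∈ copositiveFace u := mem_face_of_add_left hn hu hX hC (hXC ▸ hA)
  by_cases hX0 : X = 0
  · exact ⟨0, by rw [hX0, zero_smul]⟩
  have hdegen : ∀ Y ∈ copositiveFace u, IsExceptional Y →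
      (∀ h, formCorank (formOfMatrix hn hu ⟨Y, h⟩) = 1) → False := fun Y hY hYe hc =>
    hM (hYe.hasEigenvalue_neg_one hn hodd hu hY (mem_matrixSpace_of_mem_face hn hu hY) (hc _) _ hB)
  obtain ⟨t, -, hY, hcor⟩ := exists_maximal_sub_smul_mem_face hn hu hA hXf hX0
  have hYu := (posSemidef_of_not_isExceptional hn hu hY fun h => hdegen _ hY h (hcor h)).2
  have hY0 : A - t • X = 0 := by
    by_contra hne
    obtain ⟨k, hk⟩ : ∃ k, (A - t • X) k ≠ 0 := Function.ne_iff.1 hne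
    obtain ⟨s, -, hs, hse, hsc⟩ := hexc.exists_sub_vecMulVec hn hu hA hk fun j =>
      congrFun (hYu j) k
    exact hdegen _ hs hse hsc
  rw [sub_eq_zero] at hY0
  have ht : t ≠ 0 := by
    rintro rfl
    exact hexc.ne_zero (by rw [hY0, zero_smul])
  exact ⟨t⁻¹, by rw [hY0, smul_smul, inv_mul_cancel₀ ht, one_smul]⟩

theorem IsExceptional.exists_decomposition_of_even (hn : 5 ≤ n) (heven : Even n)
    (hu : HasCirculantSupports u) (hA : A ∈ copositiveFace u) (hexc : IsExceptional A)
    (hmem : A ∈ matrixSpace u) (hcor : formCorank (formOfMatrix hn hu ⟨A, hmem⟩) = 0) :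
    ∃ A' P : Matrix (Fin n) (Fin n) ℝ,
      HasNonMinimalCirculantZeroSupport A' ∧ P.PosSemidef ∧ P.rank = 1 ∧ A = A' + P := by
  obtain ⟨y, hy, hyu⟩ := exists_periodic_solution hn heven hu ⟨A, hmem⟩
    (isPosDefForm_of_formCorank_eq_zero hn hu hA hmem hcor)
  obtain ⟨t, ht, hA', hexc', hcor'⟩ := hexc.exists_sub_vecMulVec hn hu hA hy hyu
  have hm' := mem_matrixSpace_of_mem_face hn hu hA'
  -- The corank rises from 0 to 1, so something has been subtracted.
  have ht0 : t ≠ 0 := by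
    rintro rfl
    have h1 := hcor' hm'
    simp only [zero_smul, sub_zero, hcor] at h1
    exact zero_ne_one h1
  refine ⟨A - t • vecMulVec y y, t • vecMulVec y y,
    hexc'.hasNonMinimal_of_finrank_eq_two hn hu hA' fun s => ?_, ?_, ?_, by simp⟩
  · rw [finrank_arcKernel hn hu ⟨_, hm'⟩ s, hcor']
  · refine Matrix.PosSemidef.smul ?_ ht
    simpa using posSemidef_vecMulVec_self_star y
  · rw [← smul_vecMulVec]
    refine le_antisymm (rank_vecMulVec_le _ _) (Nat.one_le_iff_ne_zero.2 fun h => ?_)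
    obtain ⟨k, hk⟩ := Function.ne_iff.1 hy
    have h1 : (vecMulVec (t • y) y).mulVecLin = 0 :=
      LinearMap.range_eq_bot.1 (Submodule.finrank_eq_zero.1 h)
    have h2 := congrFun (congrArg (fun g => g (Pi.single k 1)) h1) k
    have h3 : t * y k * y k = 0 := by
      simpa [vecMulVec_apply] using h2
    exact mul_ne_zero (mul_ne_zero ht0 hk) hk h3

theorem minimalCase_of_formCorank_eq_zero (hn : 5 ≤ n) (hu : HasCirculantSupports u)
    (hA : A ∈ copositiveFace u) (hexc : IsExceptional A) (hmem : A ∈ matrixSpace u)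
    (hcor : formCorank (formOfMatrix hn hu ⟨A, hmem⟩) = 0) :
    MinimalCase u A (formOfMatrix hn hu ⟨A, hmem⟩) := by
  have hrank : ∀ t, Module.finrank ℝ (arcKernel A t) = 1 := fun t => by
    rw [finrank_arcKernel hn hu ⟨A, hmem⟩ t, hcor]
  have hB := isPosDefForm_of_formCorank_eq_zero hn hu hA hmem hcor
  have hzero := isZeroOf_of_mem_face hn hu hA
  have hsupp : ∀ v, IsZeroOf A v → ∃ (j : Fin n) (c : ℝ), 0 < c ∧ v = c • u j := by
    intro v hv
    obtain ⟨t, h2, h1⟩ := hexc.exists_support_arc hn hu hA hv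
    exact ⟨_, hv.exists_smul_eq hn hu hA hrank h2 h1⟩
  have hsm : ∀ j (c : ℝ), 0 < c → Function.support (c • u j) = arcSet n j := fun j c hc =>
    (Function.support_const_smul_of_ne_zero _ _ hc.ne').trans (hu j).2
  have hminz : ∀ v, IsMinimalZeroOf A v ↔ ∃ (j : Fin n) (c : ℝ), 0 < c ∧ v = c • u j := by
    intro v
    refine ⟨fun hv => hsupp v hv.1, ?_⟩
    rintro ⟨j, c, hc, rfl⟩
    refine ⟨(hzero j).smul hc, ?_⟩
    rintro ⟨w, hw, hsub⟩
    rw [hsm j c hc] at hsub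
    obtain ⟨h2, h1⟩ := (support_subset_iff_ofNat hn w j).1 hsub.1
    obtain ⟨c', hc', rfl⟩ := hw.exists_smul_eq hn hu hA hrank h2 h1
    rw [ofNat_val_eq, hsm j c' hc'] at hsub
    exact hsub.2 subset_rfl
  refine ⟨⟨hexc, u, hu, hzero, fun v hv => ?_⟩, hB, fun j => ?_, ?_, hminz, fun heven =>
    hexc.exists_decomposition_of_even hn heven hu hA hmem hcor, fun hodd hM =>
    hexc.isExtremalCopositive_of_odd hn hodd hu hA hmem hB hM⟩
  · obtain ⟨j, c, -, h⟩ := hsupp v hv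
    exact ⟨j, c, h⟩
  · rw [← ofNat_val_eq j, matrixCorank_arcSubmatrix hn, hrank]
  · ext S
    constructor
    · rintro ⟨v, hv, rfl⟩
      obtain ⟨j, c, hc, rfl⟩ := (hminz v).1 hv
      exact ⟨j, (hsm j c hc).symm⟩
    · rintro ⟨j, rfl⟩
      exact ⟨u j, (hminz _).2 ⟨j, 1, one_pos, (one_smul _ _).symm⟩, (hu j).2⟩

end Cases

theorem mainTheorem3 (n : ℕ) [NeZero n] (hn : 5 ≤ n) (u : Fin n → Fin n → ℝ)
    (hu : HasCirculantSupports u) (A : Matrix (Fin n) (Fin n) ℝ)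
    (hA : A ∈ copositiveFace u) (hexc : IsExceptional A) :
    ∃ hmem : A ∈ matrixSpace u,
      Xor (MinimalCase u A (formOfMatrix hn hu ⟨A, hmem⟩))
        (NonMinimalCase u A (formOfMatrix hn hu ⟨A, hmem⟩)) := by
  have hmem := mem_matrixSpace_of_mem_face hn hu hA
  refine ⟨hmem, ?_⟩
  have hexcl : ∀ B, MinimalCase u A B → NonMinimalCase u A B → False := fun B h1 h2 =>
    absurd ((h1.corank_submatrix 0).symm.trans (h2.corank_submatrix 0)) (by norm_num)
  have h1 := hexc.formCorank_le_one hn hu hA hmem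
  rcases Nat.le_one_iff_eq_zero_or_eq_one.1 h1 with h | h
  · have hmin := minimalCase_of_formCorank_eq_zero hn hu hA hexc hmem h
    exact Or.inl ⟨hmin, fun h' => hexcl _ hmin h'⟩
  · have hnon := nonMinimalCase_of_formCorank_eq_one hn hu hA hexc hmem h
    exact Or.inr ⟨hnon, fun h' => hexcl _ h' hnon⟩
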